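/- Let $\mathbb R$ be a finite set of relation symbols, each $r\in\mathbb R$ having an arity $\#r\ge 1$. A structure is a pair $\mathsf S=(U,\sigma)$ of an infinite set $U$ and a map $\sigma$ assigning to each $r\in\mathbb R$ a finite set $\sigma(r)\subseteq U^{\#r}$; its support $\mathrm{supp}(\sigma)$ is the (finite) set of elements occurring in the tuples of $\sigma$. A tree decomposition of $\mathsf S$ is a finite tree whose nodes are labelled by finite subsets of $U$ (bags) such that the elements of each tuple of $\sigma$ lie together in some bag, and, for each $u\in\mathrm{supp}(\sigma)$, the nodes whose bag contains $u$ form a nonempty connected set; its width is the maximal size of a bag minus one. The treewidth of $\mathsf S$ is the minimal width of a tree decomposition of $\mathsf S$, and a set of structures is treewidth bounded if the set of the treewidths of its members is finite. An external fusion of $\mathsf S_1$ and $\mathsf S_2$ is any structure isomorphic to $(\mathsf S_1'\bullet\mathsf S_2')_{/\approx}$, where $\mathsf S_1',\mathsf S_2'$ are isomorphic copies of $\mathsf S_1,\mathsf S_2$ with disjoint supports, $\mathsf S_1'\bullet\mathsf S_2'$ is obtained by taking the unions of their universes and interpretations, and $\approx$ is the least equivalence relation containing some nonempty matching $M\subseteq\mathrm{supp}(\mathsf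 S_1')\times\mathrm{supp}(\mathsf S_2')$ (distinct pairs of $M$ share no element), such that no two distinct tuples of the same relation of $\mathsf S_1'\bullet\mathsf S_2'$ become equal in the quotient. For a set $\mathcal S$ of structures, $\mathrm{EF}^*(\mathcal S)$ denotes the least set of structures that contains $\mathcal S$ and is closed under external fusion of its members (a structure may be fused with a copy of itself). $\mathsf S_1=(U_1,\sigma_1)$ is a substructure of $\mathsf S_2=(U_2,\sigma_2)$ if $U_1\subseteq U_2$ and, for all $r$, $\sigma_1(r)$ consists of the tuples of $\sigma_2(r)$ all of whose elements lie in $\mathrm{supp}(\sigma_1)$. A structure is connected if any two elements of its support are linked by a finite sequence of tuples, consecutive ones sharing an element. $\mathrm{split}(\mathcal S)$ is the set of all maximal (for the substructure relation) connected substructures of the structures in $\mathcal S$. A colour is a subset of $\mathbb R$; the colour of an element $u$ of $\mathsf S=(U,\sigma)$ is $\{r\in\mathbb R\mid (u,\dots,u)\in\sigma(r)\}$. Let $\mathsf S^\sharp$ be the multiset of the colours of the elements of $\mathrm{supp}(\sigma)$, and let $\mathcal S^{\sharp k}$ be the set of all multisets $M$ with at most $k$ elements such that $M\subseteq\mathsf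 S^\sharp$ for some $\mathsf S\in\mathcal S$. An RGB colour scheme is a partition of the set of all colours into three (possibly empty) classes, red, green and blue, such that any two (not necessarily distinct) blue colours intersect, every green colour intersects every blue colour, and every red colour is disjoint from some blue colour. A set $\mathcal S$ of structures conforms to it if (i) in each $\mathsf S\in\mathcal S$, whenever an element of the support has a red colour, all other elements of the support have blue colours, and (ii) in $\mathsf S^\sharp$, for each $\mathsf S\in\mathrm{EF}^*(\mathcal S)$, every green colour occurs at most twice. Then, for every treewidth bounded set $\mathcal S$ of structures, the following are equivalent: (1) $\mathrm{EF}^*(\mathcal S)$ is treewidth bounded; (2) for all colours $C_1,C_2$: if the multisets $\{\!\{C_1,C_1,C_1\}\!\}$ and $\{\!\{C_2,C_2,C_2\}\!\}$ both belong to $(\mathrm{EF}^*(\mathrm{split}(\mathcal S)))^{\sharp 3}$, then $C_1\cap C_2\neq\emptyset$; (3) $\mathrm{split}(\mathcal S)$ conforms to some RGB colour scheme. -/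

import Mathlib

universe u v w

/-- A relational structure `(U, σ)` over the relation symbols `R` with arities `ar`: the universe
`U` is an infinite set, and every relation symbol is interpreted by a finite set of tuples of
elements of `U`.  All universes are subsets of an (arbitrary) ambient type `V`. -/
@[ext]
structure RelStr {R : Type u} (ar : R → ℕ) (V : Type v) where
  univ : Set V
  univ_infinite : univ.Infinite
  interp : (r : R) → Set (Fin (ar r) → V)
  interp_finite : ∀ r, (interp r).Finite
  interp_mem : ∀ r, ∀ t ∈ interp r, ∀ i, t i ∈ univ

namespace RelStr

variable {R : Type u} {ar : R → ℕ} {V : Type v} {W : Type w}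

/-- The support: the elements that occur in some tuple of the interpretation. -/
def supp (S : RelStr ar V) : Set V :=
  {x | ∃ r, ∃ t ∈ S.interp r, ∃ i, t i = x}

theorem supp_finite [Finite R] (S : RelStr ar V) : S.supp.Finite := by
  have h : S.supp = ⋃ r, ⋃ t ∈ S.interp r, Set.range t := by
    ext x
    simp [supp]
  rw [h]
  exact Set.finite_iUnion fun r => (S.interp_finite r).biUnion fun t _ => Set.finite_range t

/-- Two structures (possibly over different ambient types) are isomorphic: they differ only by a
renaming of the elements of their universes. -/
def Iso (S : RelStr ar V) (T : RelStr ar W) : Prop :=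
  ∃ f : V → W, Set.BijOn f S.univ T.univ ∧
    ∀ r, T.interp r = (fun t : Fin (ar r) → V => f ∘ t) '' S.interp r

/-! ### Composition, quotient, external fusion -/

/-- The composition `S • T`.  It is only used for structures with disjoint supports, so that the
union of the two interpretations is a disjoint one. -/
def comp (S T : RelStr ar V) : RelStr ar V where
  univ := S.univ ∪ T.univ
  univ_infinite := S.univ_infinite.mono Set.subset_union_left
  interp r := S.interp r ∪ T.interp r
  interp_finite r := (S.interp_finite r).union (T.interp_finite r)
  interp_mem r t ht i := ht.imp (fun h => S.interp_mem r t h i) (fun h => T.interp_mem r t h i)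

/-- The quotient of `S` by an equivalence relation (with infinitely many classes that meet the
universe of `S`, as the universe of a structure is infinite). -/
def quot (S : RelStr ar V) (s : Setoid V) (h : (Quotient.mk s '' S.univ).Infinite) :
    RelStr ar (Quotient s) where
  univ := Quotient.mk s '' S.univ
  univ_infinite := h
  interp r := (fun t : Fin (ar r) → V => Quotient.mk s ∘ t) '' S.interp r
  interp_finite r := (S.interp_finite r).image _
  interp_mem r := by
    rintro _ ⟨t, ht, rfl⟩ i
    exact ⟨t i, S.interp_mem r t ht i, rfl⟩

/-- An equivalence relation is compatible with `S` if no two distinct tuples of a relation of `S`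
are identified. -/
def Compatible (s : Setoid V) (S : RelStr ar V) : Prop :=
  ∀ r, ∀ t ∈ S.interp r, ∀ t' ∈ S.interp r, t ≠ t' → ∃ i, ¬ s (t i) (t' i)

/-- `M` is an `A`-`B` matching: distinct pairs have no element in common. -/
def IsMatching (A B : Set V) (M : Set (V × V)) : Prop :=
  M ⊆ A ×ˢ B ∧
    ∀ p ∈ M, ∀ q ∈ M, p ≠ q → ({p.1, p.2} : Set V) ∩ {q.1, q.2} = ∅

/-- `S` is an external fusion of `S₁` and `S₂`. -/
def IsExternalFusion (S₁ S₂ S : RelStr ar V) : Prop :=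
  ∃ S₁' S₂' : RelStr ar V, Iso S₁ S₁' ∧ Iso S₂ S₂' ∧ S₁'.supp ∩ S₂'.supp = ∅ ∧
    ∃ M : Set (V × V), IsMatching S₁'.supp S₂'.supp M ∧ M.Nonempty ∧
      Compatible (Relation.EqvGen.setoid fun a b => (a, b) ∈ M) (comp S₁' S₂') ∧
      ∃ h, Iso ((comp S₁' S₂').quot (Relation.EqvGen.setoid fun a b => (a, b) ∈ M) h) S

/-- Membership in the closure of `𝒮` under external fusion. -/
inductive InFusionClosure (𝒮 : Set (RelStr ar V)) : RelStr ar V → Prop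
  | base (S : RelStr ar V) : S ∈ 𝒮 → InFusionClosure 𝒮 S
  | fuse (S₁ S₂ S : RelStr ar V) : InFusionClosure 𝒮 S₁ → InFusionClosure 𝒮 S₂ →
      IsExternalFusion S₁ S₂ S → InFusionClosure 𝒮 S

/-- The closure of a set of structures under external fusion. -/
def fusionClosure (𝒮 : Set (RelStr ar V)) : Set (RelStr ar V) :=
  {S | InFusionClosure 𝒮 S}

/-! ### Maximally connected substructures -/

/-- `S` is a substructure of `T`. -/
def IsSubstructure (S T : RelStr ar V) : Prop :=
  S.univ ⊆ T.univ ∧ ∀ r, S.interp r = {t | t ∈ T.interp r ∧ ∀ i, t i ∈ S.supp}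

/-- There is a path from `x` to `y`: a nonempty finite sequence of tuples of `S`, the first
containing `x`, the last containing `y`, and consecutive ones sharing an element. -/
def HasPath (S : RelStr ar V) (x y : V) : Prop :=
  ∃ (k : ℕ) (p : Fin (k + 1) → (r : R) × (Fin (ar r) → V)),
    (∀ i, (p i).2 ∈ S.interp (p i).1) ∧
    x ∈ Set.range (p 0).2 ∧ y ∈ Set.range (p (Fin.last k)).2 ∧
    ∀ i : Fin k, (Set.range (p i.castSucc).2 ∩ Set.range (p i.succ).2).Nonempty

/-- A structure is connected if any two elements of its support are linked by a path. -/
def IsConnected (S : RelStr ar V) : Prop :=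
  ∀ x ∈ S.supp, ∀ y ∈ S.supp, S.HasPath x y

/-- `S` is a maximally connected substructure of `T`. -/
def IsMaxConnSubstructure (S T : RelStr ar V) : Prop :=
  S.IsSubstructure T ∧ S.IsConnected ∧
    ∀ S' : RelStr ar V, S'.IsSubstructure T → S'.IsConnected → S.IsSubstructure S' → S = S'

/-- The set of all maximally connected substructures of the structures in `𝒮`. -/
def split (𝒮 : Set (RelStr ar V)) : Set (RelStr ar V) :=
  {S | ∃ T ∈ 𝒮, S.IsMaxConnSubstructure T}

/-! ### Treewidth -/

/-- A tree decomposition of `S`: a finite tree with a designated root, whose nodes are labelled by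
finite subsets ("bags") of the universe. -/
structure TreeDecomposition (S : RelStr ar V) where
  Node : Type
  [fintypeNode : Fintype Node]
  tree : SimpleGraph Node
  isTree : tree.IsTree
  root : Node
  bag : Node → Finset V
  bag_subset : ∀ n, (bag n : Set V) ⊆ S.univ
  tuple_covered : ∀ r, ∀ t ∈ S.interp r, ∃ n, ∀ i, t i ∈ bag n
  elem_connected : ∀ x ∈ S.supp, (tree.induce {n | x ∈ bag n}).Connected

/-- The width of a tree decomposition: the maximal size of a bag, minus one. -/
def TreeDecomposition.width {S : RelStr ar V} (T : S.TreeDecomposition) : ℤ :=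
  letI := T.fintypeNode
  ((Finset.univ.sup fun n => (T.bag n).card : ℕ) : ℤ) - 1

/-- The treewidth: the minimal width of a tree decomposition. -/
noncomputable def treewidth (S : RelStr ar V) : ℤ :=
  sInf (Set.range fun T : S.TreeDecomposition => T.width)

/-- A set of structures is treewidth bounded if the set of their treewidths is finite. -/
def TreewidthBounded (𝒮 : Set (RelStr ar V)) : Prop :=
  (treewidth '' 𝒮).Finite

/-! ### Colours -/

/-- The colour of an element `x`: the set of relation symbols that hold of `(x, …, x)`.  A colour
is any set of relation symbols. -/
def colour (S : RelStr ar V) (x : V) : Set R :=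
  {r | (fun _ => x) ∈ S.interp r}

/-- The multiset colour abstraction: the multiset of the colours of the elements of the support. -/
noncomputable def multisetAbs [Finite R] (S : RelStr ar V) : Multiset (Set R) :=
  S.supp_finite.toFinset.val.map S.colour

/-- The `k`-multiset colour abstraction of a set of structures: all sub-multisets, with at most `k`
elements, of the multiset colour abstractions of its members. -/
def kMultisetAbs [Finite R] (k : ℕ) (𝒮 : Set (RelStr ar V)) : Set (Multiset (Set R)) :=
  {M | ∃ S ∈ 𝒮, M ≤ S.multisetAbs ∧ M.card ≤ k}

end RelStr

/-- An RGB colour scheme: a partition of the set of all colours (sets of relation symbols) into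
three, possibly empty, classes of red, green and blue colours. -/
structure RGBScheme (R : Type u) where
  red : Set (Set R)
  green : Set (Set R)
  blue : Set (Set R)
  cover : red ∪ green ∪ blue = Set.univ
  red_green : red ∩ green = ∅
  red_blue : red ∩ blue = ∅
  green_blue : green ∩ blue = ∅
  blue_meets_blue : ∀ C₁ ∈ blue, ∀ C₂ ∈ blue, C₁ ∩ C₂ ≠ ∅
  green_meets_blue : ∀ C₁ ∈ green, ∀ C₂ ∈ blue, C₁ ∩ C₂ ≠ ∅
  red_misses_blue : ∀ C₁ ∈ red, ∃ C₂ ∈ blue, C₁ ∩ C₂ = ∅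

open Classical in
/-- A set of structures conforms to an RGB colour scheme: in each of its structures, if an element
of the support is red then all other elements of the support are blue; and in each structure of its
closure under external fusion, every green colour occurs at most twice. -/
def RelStr.ConformsTo {R : Type u} [Finite R] {ar : R → ℕ} {V : Type v}
    (𝒮 : Set (RelStr ar V)) (K : RGBScheme R) : Prop :=
  (∀ S ∈ 𝒮, ∀ x ∈ S.supp, S.colour x ∈ K.red →
      ∀ y ∈ S.supp \ {x}, S.colour y ∈ K.blue) ∧
  ∀ S ∈ RelStr.fusionClosure 𝒮, ∀ C ∈ K.green, S.multisetAbs.count C ≤ 2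

/-! ### Trees -/

namespace SimpleGraph

variable {M N : Type*}

/-! Structures are replaced by their finite sets of facts. Up to renaming, the members of the fusion
closure are the sets described by `Glue`: copies of the given structures united step by step, where
the two parts have meeting supports and no common fact (`glue_of_mem_fusionClosure`,
`exists_fusionClosure_of_glue`). Having no common fact forces the two colours of a shared element to
be disjoint. A colour is abundant if it occurs three times in some fusion of components; condition
(2) says that abundant colours pairwise meet.

(1) implies (2). Given disjoint abundant colours `C₁` and `C₂`, take three elements of each. One of
each is used to glue the two fusions together. The result keeps two ports of colour `C₁` and two of
colour `C₂`, so its copies can be laid out as a grid, left port on right port and upper port on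
lower port. Rows and columns are connected, so a Helly argument in the decomposition tree makes the
treewidth unbounded (`not_hasTreeDec_gridBlock`). This grid is glued from components, but it extends
to a fusion of whole structures (`Glue.exists_extension`).

(2) implies (3). Abundant colours are blue, colours disjoint from an abundant one are red, the rest
green. If an element `x` misses an abundant colour, copies of its structure can be attached by `x`
at three elements of that colour, so every other element has an abundant, that is blue, colour
(`abundant_of_misses`).

(3) implies (1). The blue colours are first closed upwards. By induction, each fusion of components
is of one of two kinds: it has exactly one red element and otherwise blue ones, or it has no red
element (`Glue.oneRed_or_noRed`). A shared element that is blue on one side is red on the other.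
Hence two fusions of the first kind share at most their red elements, a mixed pair shares just one
element, and two fusions of the second kind share only green elements. The number of green elements
is bounded, so they can be kept in one bag and the width does not accumulate. Fusions of
disconnected structures are unions of fact-disjoint fusions of components, and these are merged as
long as they meet (`hasTreeDec_sUnion_of_glue`). -/

theorem Reachable.exists_of_closed {A : SimpleGraph M} {B : SimpleGraph N} (f : M → N)
    (h : ∀ u y, B.Adj (f u) y → ∃ v, f v = y ∧ A.Adj u v) {u : M} {y : N}
    (hr : B.Reachable (f u) y) : ∃ v, f v = y ∧ A.Reachable u v := by
  rw [reachable_iff_reflTransGen] at hr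
  induction hr with
  | refl => exact ⟨u, rfl, Reachable.refl u⟩
  | tail _ hadj ih =>
    obtain ⟨v, rfl, hv⟩ := ih
    obtain ⟨w, rfl, hw⟩ := h v _ hadj
    exact ⟨w, rfl, hv.trans hw.reachable⟩

/-- Every edge is a bridge: a walk that avoids it never leaves the summand it starts in, so it would
already join the two ends there. -/
theorem isAcyclic_sum {A : SimpleGraph M} {B : SimpleGraph N} (hA : A.IsAcyclic)
    (hB : B.IsAcyclic) : (A ⊕g B).IsAcyclic := by
  rw [isAcyclic_iff_forall_adj_isBridge] at hA hB ⊢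
  rintro (v | v) (w | w) hvw
  · rw [isBridge_iff]
    intro hr
    have hvw' : A.Adj v w := by simpa using hvw
    obtain ⟨z, hz, hr'⟩ := Reachable.exists_of_closed (A := A.deleteEdges {s(v, w)})
      (Sum.inl : M → M ⊕ N) (by
        rintro u (y | y) h
        · exact ⟨y, rfl, by simpa [deleteEdges_adj] using h⟩
        · simp [deleteEdges_adj] at h) hr
    cases Sum.inl_injective hz
    exact (isBridge_iff.1 (hA hvw')) hr'
  · simp at hvw
  · simp at hvw
  · rw [isBridge_iff]
    intro hr
    have hvw' : B.Adj v w := by simpa using hvw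
    obtain ⟨z, hz, hr'⟩ := Reachable.exists_of_closed (A := B.deleteEdges {s(v, w)})
      (Sum.inr : N → M ⊕ N) (by
        rintro u (y | y) h
        · simp [deleteEdges_adj] at h
        · exact ⟨y, rfl, by simpa [deleteEdges_adj] using h⟩) hr
    cases Sum.inr_injective hz
    exact (isBridge_iff.1 (hB hvw')) hr'

theorem isTree_sum_sup_edge {A : SimpleGraph M} {B : SimpleGraph N} (hA : A.IsTree)
    (hB : B.IsTree) (a : M) (b : N) :
    ((A ⊕g B) ⊔ edge (Sum.inl a) (Sum.inr b)).IsTree := by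
  have hl : ∀ u, ((A ⊕g B) ⊔ edge (Sum.inl a) (Sum.inr b)).Reachable (Sum.inl a) u := by
    rintro (u | u)
    · exact ((hA.connected.preconnected a u).map
        (Embedding.sumInl (G := A) (H := B)).toHom).mono le_sup_left
    · refine Reachable.trans (v := Sum.inr b) ?_ (((hB.connected.preconnected b u).map
        (Embedding.sumInr (G := A) (H := B)).toHom).mono le_sup_left)
      exact Adj.reachable (by simp [edge_adj])
  refine ⟨(connected_iff_exists_forall_reachable _).2 ⟨Sum.inl a, hl⟩, ?_⟩
  refine IsAcyclic.sup_edge_of_not_reachable ?_ (isAcyclic_sum hA.isAcyclic hB.isAcyclic)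
  intro hr
  obtain ⟨z, hz, _⟩ := Reachable.exists_of_closed (A := A) (Sum.inl : M → M ⊕ N) (by
        rintro u (y | y) h
        · exact ⟨y, rfl, by simpa using h⟩
        · simp at h) hr
  simp at hz

/-- Pairwise meeting connected sets of nodes of a finite tree have a common node. -/
theorem IsTree.exists_mem_of_pairwise_meet {N ι : Type*} [Finite N] {T : SimpleGraph N}
    (hT : T.IsTree) (A : ι → Set N) (hA : ∀ i, (T.induce (A i)).Connected)
    (hAA : ∀ i j, (A i ∩ A j).Nonempty) : ∃ n, ∀ i, n ∈ A i := by
  classical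
  have := Fintype.ofFinite N
  by_contra! hno
  choose c hc using hno
  -- Each node points to its neighbour in the direction of a set that misses it. That set is
  -- connected, so all of it lies on the neighbour's side.
  have hstep : ∀ n, ∃ m, T.Adj n m ∧ ∀ z ∈ A (c n), (T.deleteIncidenceSet n).Reachable m z := by
    intro n
    obtain ⟨⟨a, ha⟩⟩ := (hA (c n)).nonempty
    obtain ⟨p, hp, -⟩ := hT.existsUnique_path n a
    cases p with
    | nil => exact absurd ha (hc n)
    | @cons _ m _ hadj q =>
      refine ⟨m, hadj, fun z hz => ?_⟩
      rw [Walk.cons_isPath_iff] at hp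
      have h1 : (T.deleteIncidenceSet n).Reachable m a := by
        refine ⟨q.transfer _ ?_⟩
        intro e he
        rw [edgeSet_deleteIncidenceSet]
        refine ⟨q.edges_subset_edgeSet he, fun hmem => hp.2 ?_⟩
        exact q.mem_support_of_mem_edges he hmem.2
      have h2 : (T.deleteIncidenceSet n).Reachable a z := by
        have := (hA (c n)).preconnected ⟨a, ha⟩ ⟨z, hz⟩
        refine this.map (G' := T.deleteIncidenceSet n) ⟨fun x => x.1, ?_⟩
        rintro ⟨x, hx⟩ ⟨y, hy⟩ hxy
        rw [deleteIncidenceSet_adj]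
        exact ⟨hxy, fun h => hc n (h ▸ hx), fun h => hc n (h ▸ hy)⟩
      exact h1.trans h2
  choose f hf using hstep
  have hcard := hT.card_edgeFinset
  -- A tree has one node more than edges, so two nodes `n` and `m` point along the same edge,
  -- towards each other. Their two sets then lie on opposite sides of a bridge and cannot meet.
  obtain ⟨n, -, m, -, hnm, he⟩ := Finset.exists_ne_map_eq_of_card_lt_of_maps_to
    (s := (Finset.univ : Finset N)) (t := T.edgeFinset) (f := fun n => s(n, f n))
    (by rw [Finset.card_univ]; omega)
    (by intro n _; simpa using (hf n).1)
  have hfn : f n = m ∧ f m = n := by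
    rcases Sym2.eq_iff.1 he with ⟨h, _⟩ | ⟨h1, h2⟩
    · exact absurd h hnm
    · exact ⟨h2, h1.symm⟩
  obtain ⟨z, hz1, hz2⟩ := hAA (c n) (c m)
  have h1 := (hf n).2 z hz1
  have h2 := (hf m).2 z hz2
  rw [hfn.1] at h1
  rw [hfn.2] at h2
  have hle1 : T.deleteIncidenceSet n ≤ T.deleteEdges {s(n, m)} := by
    intro x y h
    rw [deleteIncidenceSet_adj] at h
    rw [deleteEdges_adj]
    refine ⟨h.1, fun h' => ?_⟩
    rcases Sym2.eq_iff.1 h' with h' | h' <;> simp_all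
  have hle2 : T.deleteIncidenceSet m ≤ T.deleteEdges {s(n, m)} := by
    intro x y h
    rw [deleteIncidenceSet_adj] at h
    rw [deleteEdges_adj]
    refine ⟨h.1, fun h' => ?_⟩
    rcases Sym2.eq_iff.1 h' with h' | h' <;> simp_all
  have hadj : T.Adj n m := hfn.1 ▸ (hf n).1
  exact isBridge_iff.1 (isAcyclic_iff_forall_adj_isBridge.1 hT.isAcyclic hadj)
    ((h2.mono hle2).trans (h1.mono hle1).symm)

theorem connected_induce_image {A : SimpleGraph M} {B : SimpleGraph N} (f : A ↪g B) {s : Set M}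
    (hs : (A.induce s).Connected) : (B.induce (f '' s)).Connected := by
  refine hs.map (f := ⟨fun x => ⟨f x.1, x.1, x.2, rfl⟩, ?_⟩) ?_
  · rintro ⟨x, hx⟩ ⟨y, hy⟩ h
    exact f.map_adj_iff.2 h
  · rintro ⟨_, x, hx, rfl⟩
    exact ⟨⟨x, hx⟩, rfl⟩

end SimpleGraph

/-! ### Tree decompositions of set systems -/

/-- The ground set `P` has a tree decomposition with bags of at most `k` elements, such that every
member of `H` is contained in some bag. -/
def HasTreeDec {V : Type*} (P : Set V) (H : Set (Set V)) (k : ℕ) : Prop :=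
  ∃ (N : Type) (_ : Finite N) (T : SimpleGraph N) (bag : N → Finset V), T.IsTree ∧
    (∀ n, (bag n : Set V) ⊆ P) ∧ (∀ h ∈ H, ∃ n, h ⊆ (bag n : Set V)) ∧
    (∀ x ∈ P, (T.induce {n | x ∈ bag n}).Connected) ∧ ∀ n, (bag n).card ≤ k

namespace HasTreeDec

open SimpleGraph

variable {V W : Type*} {P Q : Set V} {H I : Set (Set V)} {k l : ℕ}

theorem mono (h : HasTreeDec P H k) (hI : ∀ i ∈ I, ∃ h ∈ H, i ⊆ h) (hkl : k ≤ l) :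
    HasTreeDec P I l := by
  obtain ⟨N, fN, T, bag, hT, hP, hH, hc, hk⟩ := h
  refine ⟨N, fN, T, bag, hT, hP, fun i hi => ?_, hc, fun n => (hk n).trans hkl⟩
  obtain ⟨h, hh, hih⟩ := hI i hi
  obtain ⟨n, hn⟩ := hH h hh
  exact ⟨n, hih.trans hn⟩

theorem mono_edges (h : HasTreeDec P H k) (hI : I ⊆ H) : HasTreeDec P I k :=
  h.mono (fun i hi => ⟨i, hI hi, subset_rfl⟩) le_rfl

theorem insert_singleton (h : HasTreeDec P H k) {x : V} (hx : x ∈ P) :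
    HasTreeDec P (insert {x} H) k := by
  obtain ⟨N, fN, T, bag, hT, hP, hH, hc, hk⟩ := h
  refine ⟨N, fN, T, bag, hT, hP, ?_, hc, hk⟩
  rintro i (rfl | hi)
  · obtain ⟨⟨n, hn⟩⟩ := (hc x hx).nonempty
    exact ⟨n, by simpa using hn⟩
  · exact hH i hi

theorem insert_empty (h : HasTreeDec P H k) : HasTreeDec P (insert ∅ H) k := by
  obtain ⟨N, fN, T, bag, hT, hP, hH, hc, hk⟩ := h
  refine ⟨N, fN, T, bag, hT, hP, ?_, hc, hk⟩
  rintro i (rfl | hi)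
  · obtain ⟨n⟩ := hT.connected.nonempty
    exact ⟨n, Set.empty_subset _⟩
  · exact hH i hi

theorem of_finite {X : Finset V} (hX : X.card ≤ k) : HasTreeDec (X : Set V) {(X : Set V)} k := by
  refine ⟨Unit, inferInstance, ⊥, fun _ => X, IsTree.of_subsingleton, fun _ => subset_rfl,
    ?_, fun x hx => ?_, fun _ => hX⟩
  · rintro _ rfl
    exact ⟨(), subset_rfl⟩
  · have : Nonempty {n : Unit | x ∈ X} := ⟨⟨(), hx⟩⟩
    exact (IsTree.of_subsingleton).connected

/-- The node set of a surviving element is untouched when the other elements are deleted from the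
bags. This makes treewidth monotone in the set of facts. -/
theorem restrict (h : HasTreeDec P H k) (hQ : Q ⊆ P) :
    HasTreeDec Q ((fun h => h ∩ Q) '' H) k := by
  classical
  obtain ⟨N, fN, T, bag, hT, hP, hH, hc, hk⟩ := h
  refine ⟨N, fN, T, fun n => (bag n).filter (· ∈ Q), hT, fun n x hx => ?_, ?_, fun x hx => ?_,
    fun n => (Finset.card_filter_le _ _).trans (hk n)⟩
  · exact (Finset.mem_filter.1 hx).2
  · rintro _ ⟨i, hi, rfl⟩
    obtain ⟨n, hn⟩ := hH i hi
    refine ⟨n, fun x hx => ?_⟩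
    have := hn hx.1
    simp only [Finset.mem_coe, Finset.mem_filter] at this ⊢
    exact ⟨this, hx.2⟩
  · have : {n | x ∈ (bag n).filter (· ∈ Q)} = {n | x ∈ bag n} := by
      ext n
      simp [hx]
    rw [this]
    exact hc x (hQ hx)

theorem image (h : HasTreeDec P H k) {f : V → W} (hf : P.InjOn f) :
    HasTreeDec (f '' P) ((fun h => f '' h) '' H) k := by
  classical
  obtain ⟨N, fN, T, bag, hT, hP, hH, hc, hk⟩ := h
  refine ⟨N, fN, T, fun n => (bag n).image f, hT, fun n x hx => ?_, ?_, ?_,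
    fun n => Finset.card_image_le.trans (hk n)⟩
  · rw [Finset.coe_image] at hx
    exact Set.image_mono (hP n) hx
  · rintro _ ⟨i, hi, rfl⟩
    obtain ⟨n, hn⟩ := hH i hi
    refine ⟨n, ?_⟩
    rw [Finset.coe_image]
    exact Set.image_mono hn
  · rintro _ ⟨x, hx, rfl⟩
    have : {n | f x ∈ (bag n).image f} = {n | x ∈ bag n} := by
      ext n
      change f x ∈ (bag n).image f ↔ x ∈ bag n
      rw [Finset.mem_image]
      constructor
      · rintro ⟨y, hy, hxy⟩
        rwa [← hf (hP n hy) hx hxy]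
      · exact fun h => ⟨x, h, rfl⟩
    rw [this]
    exact hc x hx

/-- Adding `X` to every bag is harmless for connectedness, as an element of `X` then occupies the
whole tree. The cost is `X.card`, and `X` can serve as an interface for `join`. -/
theorem add_all (h : HasTreeDec P H k) {X : Finset V} (hX : (X : Set V) ⊆ P) :
    HasTreeDec P (insert (X : Set V) ((fun h => h ∪ X) '' H)) (k + X.card) := by
  classical
  obtain ⟨N, fN, T, bag, hT, hP, hH, hc, hk⟩ := h
  refine ⟨N, fN, T, fun n => bag n ∪ X, hT, fun n x hx => ?_, ?_, fun x hx => ?_,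
    fun n => (Finset.card_union_le _ _).trans (by have := hk n; omega)⟩
  · rcases Finset.mem_union.1 hx with hx | hx
    · exact hP n hx
    · exact hX hx
  · rintro _ (rfl | ⟨i, hi, rfl⟩)
    · obtain ⟨n⟩ := hT.connected.nonempty
      exact ⟨n, by simp⟩
    · obtain ⟨n, hn⟩ := hH i hi
      refine ⟨n, ?_⟩
      rw [Finset.coe_union]
      exact Set.union_subset_union_left _ hn
  · by_cases hxX : x ∈ X
    · have : {n | x ∈ bag n ∪ X} = Set.univ := by
        ext n
        simp [hxX]
      rw [this]
      exact (induceUnivIso T).connected_iff.2 hT.connected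
    · have : {n | x ∈ bag n ∪ X} = {n | x ∈ bag n} := by
        ext n
        simp [hxX]
      rw [this]
      exact hc x hx

/-- An edge is laid between a bag on each side that contains the whole interface. The node set of a
shared element is then two connected sets linked by that edge, and that of any other element lies in
one tree. -/
theorem join {P₁ P₂ : Set V} {H₁ H₂ : Set (Set V)} (h₁ : HasTreeDec P₁ H₁ k)
    (h₂ : HasTreeDec P₂ H₂ k) (hm₁ : ∃ h ∈ H₁, P₁ ∩ P₂ ⊆ h)
    (hm₂ : ∃ h ∈ H₂, P₁ ∩ P₂ ⊆ h) :
    HasTreeDec (P₁ ∪ P₂) (H₁ ∪ H₂) k := by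
  obtain ⟨N₁, fN₁, T₁, bag₁, hT₁, hP₁, hH₁, hc₁, hk₁⟩ := h₁
  obtain ⟨N₂, fN₂, T₂, bag₂, hT₂, hP₂, hH₂, hc₂, hk₂⟩ := h₂
  obtain ⟨h₁, hh₁, hs₁⟩ := hm₁
  obtain ⟨h₂, hh₂, hs₂⟩ := hm₂
  obtain ⟨a, ha⟩ := hH₁ _ hh₁
  obtain ⟨b, hb⟩ := hH₂ _ hh₂
  replace ha := hs₁.trans ha
  replace hb := hs₂.trans hb
  let T := (T₁ ⊕g T₂) ⊔ edge (Sum.inl a) (Sum.inr b)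
  have e₁ : ∀ {s : Set N₁}, (T₁.induce s).Connected → (T.induce (Sum.inl '' s)).Connected := by
    intro s hs
    refine connected_induce_image (⟨⟨Sum.inl, Sum.inl_injective⟩, ?_⟩ : T₁ ↪g T) hs
    intro u v
    simp [T, edge_adj]
  have e₂ : ∀ {s : Set N₂}, (T₂.induce s).Connected → (T.induce (Sum.inr '' s)).Connected := by
    intro s hs
    refine connected_induce_image (⟨⟨Sum.inr, Sum.inr_injective⟩, ?_⟩ : T₂ ↪g T) hs
    intro u v
    simp [T, edge_adj]
  refine ⟨N₁ ⊕ N₂, inferInstance, T, Sum.elim bag₁ bag₂, isTree_sum_sup_edge hT₁ hT₂ a b,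
    ?_, ?_, ?_, ?_⟩
  · rintro (n | n)
    · exact (hP₁ n).trans Set.subset_union_left
    · exact (hP₂ n).trans Set.subset_union_right
  · rintro i (hi | hi)
    · obtain ⟨n, hn⟩ := hH₁ i hi
      exact ⟨Sum.inl n, hn⟩
    · obtain ⟨n, hn⟩ := hH₂ i hi
      exact ⟨Sum.inr n, hn⟩
  · intro x hx
    have hset : {n | x ∈ Sum.elim bag₁ bag₂ n} =
        Sum.inl '' {n | x ∈ bag₁ n} ∪ Sum.inr '' {n | x ∈ bag₂ n} := by
      ext (n | n) <;> simp
    rw [hset]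
    by_cases hx₁ : x ∈ P₁
    · by_cases hx₂ : x ∈ P₂
      · have hab : T.Adj (Sum.inl a) (Sum.inr b) := by simp [T, edge_adj]
        have h1 := induce_union_connected (e₁ (hc₁ x hx₁)).preconnected
          (induce_pair_connected_of_adj hab).preconnected
          ⟨Sum.inl a, ⟨a, ha ⟨hx₁, hx₂⟩, rfl⟩, Or.inl rfl⟩
        have h2 := induce_union_connected h1.preconnected (e₂ (hc₂ x hx₂)).preconnected
          ⟨Sum.inr b, Or.inr (Or.inr rfl), ⟨b, hb ⟨hx₁, hx₂⟩, rfl⟩⟩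
        have heq : (Sum.inl '' {n | x ∈ bag₁ n} ∪ Sum.inr '' {n | x ∈ bag₂ n} : Set (N₁ ⊕ N₂)) =
            Sum.inl '' {n | x ∈ bag₁ n} ∪ {Sum.inl a, Sum.inr b} ∪
              Sum.inr '' {n | x ∈ bag₂ n} := by
          ext n
          constructor
          · rintro (h | h)
            · exact Or.inl (Or.inl h)
            · exact Or.inr h
          · rintro ((h | rfl | rfl) | h)
            · exact Or.inl h
            · exact Or.inl ⟨a, ha ⟨hx₁, hx₂⟩, rfl⟩
            · exact Or.inr ⟨b, hb ⟨hx₁, hx₂⟩, rfl⟩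
            · exact Or.inr h
        rw [heq]
        exact h2
      · have : {n | x ∈ bag₂ n} = ∅ := by
          ext n
          exact iff_of_false (fun h => hx₂ (hP₂ n h)) id
        rw [this, Set.image_empty, Set.union_empty]
        exact e₁ (hc₁ x hx₁)
    · have : {n | x ∈ bag₁ n} = ∅ := by
        ext n
        exact iff_of_false (fun h => hx₁ (hP₁ n h)) id
      rw [this, Set.image_empty, Set.empty_union]
      exact e₂ (hc₂ x (hx.resolve_left hx₁))
  · rintro (n | n)
    · exact hk₁ n
    · exact hk₂ n

end HasTreeDec

/-! ### Sets of facts -/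

/-- A fact: a relation symbol together with a tuple of elements. -/
abbrev RelFact {R : Type u} (ar : R → ℕ) (V : Type v) := (r : R) × (Fin (ar r) → V)

namespace RelFact

variable {R : Type u} {ar : R → ℕ} {V : Type v} {W : Type w}

/-- The renaming of the elements of a fact. -/
def rename (f : V → W) (p : RelFact ar V) : RelFact ar W := ⟨p.1, f ∘ p.2⟩

/-- The elements that occur in a set of facts. -/
def supp (F : Set (RelFact ar V)) : Set V := {x | ∃ p ∈ F, x ∈ Set.range p.2}

/-- The colour of an element with respect to a set of facts. -/
def colour (F : Set (RelFact ar V)) (x : V) : Set R := {r | (⟨r, fun _ => x⟩ : RelFact ar V) ∈ F}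

/-- The sets of elements of the single facts. -/
def edges (F : Set (RelFact ar V)) : Set (Set V) := (fun p => Set.range p.2) '' F

/-- Two elements are linked if they are joined by a chain of facts. -/
def Link (F : Set (RelFact ar V)) : V → V → Prop :=
  Relation.ReflTransGen fun x y => ∃ p ∈ F, x ∈ Set.range p.2 ∧ y ∈ Set.range p.2

/-- Any two elements of the support are linked. -/
def Linked (F : Set (RelFact ar V)) : Prop := ∀ x ∈ supp F, ∀ y ∈ supp F, Link F x y

variable {F G : Set (RelFact ar V)} {f : V → W} {x y z : V}

theorem range_rename (p : RelFact ar V) : Set.range (rename f p).2 = f '' Set.range p.2 :=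
  Set.range_comp f p.2

theorem range_subset_supp {p : RelFact ar V} (hp : p ∈ F) : Set.range p.2 ⊆ supp F :=
  fun _ hx => ⟨p, hp, hx⟩

theorem supp_mono (h : F ⊆ G) : supp F ⊆ supp G :=
  fun _ ⟨p, hp, hx⟩ => ⟨p, h hp, hx⟩

theorem supp_union : supp (F ∪ G) = supp F ∪ supp G := by
  ext x
  constructor
  · rintro ⟨p, hp | hp, hx⟩
    · exact Or.inl ⟨p, hp, hx⟩
    · exact Or.inr ⟨p, hp, hx⟩
  · rintro (h | h)
    · exact supp_mono Set.subset_union_left h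
    · exact supp_mono Set.subset_union_right h

theorem supp_rename : supp (rename f '' F) = f '' supp F := by
  ext x
  constructor
  · rintro ⟨_, ⟨p, hp, rfl⟩, hx⟩
    rw [range_rename] at hx
    exact Set.image_mono (range_subset_supp hp) hx
  · rintro ⟨_, ⟨p, hp, i, rfl⟩, rfl⟩
    exact ⟨_, ⟨p, hp, rfl⟩, i, rfl⟩

theorem finite_supp (h : F.Finite) : (supp F).Finite := by
  have : supp F = ⋃ p ∈ F, Set.range p.2 := by
    ext x
    simp only [supp, Set.mem_iUnion, exists_prop]
    rfl
  rw [this]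
  exact h.biUnion fun p _ => Set.finite_range p.2

theorem edges_union : edges (F ∪ G) = edges F ∪ edges G := Set.image_union ..

theorem edges_rename : edges (rename f '' F) = (fun h => f '' h) '' edges F := by
  simp only [edges, Set.image_image, range_rename]

theorem rename_congr {g : V → W} {p : RelFact ar V} (h : Set.EqOn f g (Set.range p.2)) :
    rename f p = rename g p := by
  obtain ⟨r, t⟩ := p
  simp only [rename, Sigma.mk.injEq, heq_eq_eq, true_and]
  funext i
  exact h ⟨i, rfl⟩

theorem image_rename_congr {g : V → W} (h : Set.EqOn f g (supp F)) :
    rename f '' F = rename g '' F :=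
  Set.image_congr fun _ hp => rename_congr (h.mono (range_subset_supp hp))

theorem image_rename_of_fixed {f : V → V} (h : ∀ x ∈ supp F, f x = x) : rename f '' F = F := by
  rw [image_rename_congr (g := id) h]
  exact Set.image_id F

theorem injOn_rename {f : V → W} (h : (supp F).InjOn f) : F.InjOn (rename f) := by
  rintro ⟨r, t⟩ hp ⟨r', t'⟩ hq hpq
  obtain rfl : r = r' := congrArg Sigma.fst hpq
  simp only [rename, Sigma.mk.injEq, heq_eq_eq, true_and] at hpq ⊢
  funext i
  exact h ⟨_, hp, i, rfl⟩ ⟨_, hq, i, rfl⟩ (congrFun hpq i)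

theorem injective_rename (h : Function.Injective f) :
    Function.Injective (rename f : RelFact ar V → RelFact ar W) := by
  rw [← Set.injOn_univ]
  exact injOn_rename h.injOn

theorem colour_union (x : V) : colour (F ∪ G) x = colour F x ∪ colour G x := rfl

theorem mem_supp_of_mem_colour (har : ∀ r, 1 ≤ ar r) {r : R} (h : r ∈ colour F x) :
    x ∈ supp F := ⟨_, h, ⟨0, har r⟩, rfl⟩

theorem colour_eq_empty (har : ∀ r, 1 ≤ ar r) (h : x ∉ supp F) : colour F x = ∅ :=
  Set.eq_empty_of_forall_notMem fun _ hr => h (mem_supp_of_mem_colour har hr)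

theorem colour_union_left (har : ∀ r, 1 ≤ ar r) (h : x ∉ supp G) :
    colour (F ∪ G) x = colour F x := by
  rw [colour_union, colour_eq_empty har h, Set.union_empty]

theorem colour_union_right (har : ∀ r, 1 ≤ ar r) (h : x ∉ supp F) :
    colour (F ∪ G) x = colour G x := by
  rw [colour_union, colour_eq_empty har h, Set.empty_union]

theorem colour_rename (hf : (supp F).InjOn f) (hx : x ∈ supp F) :
    colour (rename f '' F) (f x) = colour F x := by
  ext r
  constructor
  · rintro ⟨⟨r', t⟩, hp, hpr⟩
    obtain rfl : r' = r := congrArg Sigma.fst hpr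
    simp only [rename, Sigma.mk.injEq, heq_eq_eq, true_and] at hpr
    have : t = fun _ => x := by
      funext i
      exact hf ⟨_, hp, i, rfl⟩ hx (congrFun hpr i)
    subst this
    exact hp
  · intro h
    exact ⟨_, h, rfl⟩

theorem colour_inter_of_disjoint (h : Disjoint F G) (x : V) : colour F x ∩ colour G x = ∅ :=
  Set.eq_empty_of_forall_notMem fun _ hr => Set.disjoint_left.1 h hr.1 hr.2

theorem range_nonempty (har : ∀ r, 1 ≤ ar r) (p : RelFact ar V) : (Set.range p.2).Nonempty :=
  ⟨_, ⟨0, har p.1⟩, rfl⟩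

/-- Sets of facts with at most one common element, of disjoint colours, are disjoint. -/
theorem disjoint_of_supp_inter_subset
    (h : supp F ∩ supp G ⊆ {x}) (hc : colour F x ∩ colour G x = ∅) : Disjoint F G := by
  rw [Set.disjoint_left]
  rintro ⟨r, t⟩ hF hG
  have ht : t = fun _ => x := by
    funext i
    exact h ⟨⟨_, hF, i, rfl⟩, ⟨_, hG, i, rfl⟩⟩
  subst ht
  exact Set.notMem_empty r (hc ▸ ⟨hF, hG⟩)

/-! ### Links -/

theorem Link.symm (h : Link F x y) : Link F y x := by
  induction h with
  | refl => exact .refl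
  | tail _ h ih =>
    obtain ⟨p, hp, h1, h2⟩ := h
    exact .head ⟨p, hp, h2, h1⟩ ih

theorem Link.mono (hFG : F ⊆ G) (h : Link F x y) : Link G x y :=
  Relation.ReflTransGen.mono (fun _ _ ⟨p, hp, h⟩ => ⟨p, hFG hp, h⟩) _ _ h

theorem link_of_mem {p : RelFact ar V} (hp : p ∈ F) (hx : x ∈ Set.range p.2)
    (hy : y ∈ Set.range p.2) : Link F x y := .single ⟨p, hp, hx, hy⟩

theorem Link.mem_supp (h : Link F x y) (hx : x ∈ supp F) : y ∈ supp F := by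
  cases h with
  | refl => exact hx
  | tail _ h =>
    obtain ⟨p, hp, -, h2⟩ := h
    exact range_subset_supp hp h2

theorem Link.rename (h : Link F x y) : Link (rename f '' F) (f x) (f y) := by
  induction h with
  | refl => exact .refl
  | tail _ h ih =>
    obtain ⟨p, hp, ⟨i, rfl⟩, ⟨j, rfl⟩⟩ := h
    exact .tail ih ⟨_, ⟨p, hp, rfl⟩, ⟨i, rfl⟩, ⟨j, rfl⟩⟩

theorem Linked.rename (h : Linked F) : Linked (RelFact.rename f '' F) := by
  intro x hx y hy
  rw [supp_rename] at hx hy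
  obtain ⟨x, hx, rfl⟩ := hx
  obtain ⟨y, hy, rfl⟩ := hy
  exact (h x hx y hy).rename

theorem Linked.union (hF : Linked F) (hG : Linked G) (h : (supp F ∩ supp G).Nonempty) :
    Linked (F ∪ G) := by
  obtain ⟨z, hzF, hzG⟩ := h
  have key : ∀ x ∈ supp (F ∪ G), Link (F ∪ G) x z := by
    intro x hx
    rw [supp_union] at hx
    rcases hx with hx | hx
    · exact (hF x hx z hzF).mono Set.subset_union_left
    · exact (hG x hx z hzG).mono Set.subset_union_right
  exact fun x hx y hy => (key x hx).trans (key y hy).symm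

/-- The facts of the component of an element. -/
def component (F : Set (RelFact ar V)) (x : V) : Set (RelFact ar V) :=
  {p ∈ F | ∀ y ∈ Set.range p.2, Link F x y}

theorem component_subset : component F x ⊆ F := fun _ h => h.1

theorem mem_component {p : RelFact ar V} (hp : p ∈ F) (hy : y ∈ Set.range p.2) (h : Link F x y) :
    p ∈ component F x := ⟨hp, fun _ hz => h.trans (link_of_mem hp hy hz)⟩

theorem Link.component (h : Link F x y) : Link (component F x) x y := by
  induction h with
  | refl => exact .refl
  | tail h h' ih =>
    obtain ⟨p, hp, h1, h2⟩ := h'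
    exact ih.trans (link_of_mem (mem_component hp h1 h) h1 h2)

theorem supp_component (hx : x ∈ supp F) : supp (component F x) = {y | Link F x y} := by
  ext y
  constructor
  · rintro ⟨p, hp, hy⟩
    exact hp.2 y hy
  · intro h
    obtain ⟨p, hp, hy⟩ := h.mem_supp hx
    exact ⟨p, mem_component hp hy h, hy⟩

theorem linked_component (hx : x ∈ supp F) : Linked (component F x) := by
  intro y hy z hz
  rw [supp_component hx] at hy hz
  exact (Link.component hy).symm.trans (Link.component hz)

end RelFact

/-! ### Tree decompositions of sets of facts -/

namespace RelFact

variable {R : Type u} {ar : R → ℕ} {V : Type v} {W : Type w}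

/-- A tree decomposition of a set of facts with bags of at most `k` elements. -/
def HasTreeDec (F : Set (RelFact ar V)) (k : ℕ) : Prop := _root_.HasTreeDec (supp F) (edges F) k

variable {F G : Set (RelFact ar V)} {k : ℕ}

theorem HasTreeDec.subset (h : HasTreeDec F k) (hG : G ⊆ F) : HasTreeDec G k := by
  refine (_root_.HasTreeDec.restrict h (supp_mono hG)).mono ?_ le_rfl
  rintro _ ⟨p, hp, rfl⟩
  exact ⟨_, ⟨_, ⟨p, hG hp, rfl⟩, rfl⟩, Set.subset_inter subset_rfl (range_subset_supp hp)⟩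

theorem HasTreeDec.rename (h : HasTreeDec F k) {f : V → W} (hf : (supp F).InjOn f) :
    HasTreeDec (rename f '' F) k := by
  unfold HasTreeDec
  rw [supp_rename, edges_rename]
  exact _root_.HasTreeDec.image h hf

/-- With an empty interface any two bags may be linked; the empty set, which lies in some bag, plays
the part of the interface. -/
theorem HasTreeDec.union_of_disjoint (hF : HasTreeDec F k) (hG : HasTreeDec G k)
    (h : Disjoint (supp F) (supp G)) : HasTreeDec (F ∪ G) k := by
  unfold HasTreeDec
  rw [supp_union, edges_union]
  refine (_root_.HasTreeDec.join (_root_.HasTreeDec.insert_empty hF)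
    (_root_.HasTreeDec.insert_empty hG) ?_ ?_).mono_edges ?_
  · exact ⟨∅, Or.inl rfl, h.inter_eq.subset⟩
  · exact ⟨∅, Or.inl rfl, h.inter_eq.subset⟩
  · exact Set.union_subset_union (Set.subset_insert _ _) (Set.subset_insert _ _)

theorem hasTreeDec_empty : HasTreeDec (∅ : Set (RelFact ar V)) k := by
  have h := _root_.HasTreeDec.of_finite (X := (∅ : Finset V)) (k := k) (by simp)
  have hs : supp (∅ : Set (RelFact ar V)) = ((∅ : Finset V) : Set V) := by
    ext x
    simp [supp]
  unfold HasTreeDec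
  rw [hs]
  refine h.mono_edges ?_
  rintro _ ⟨p, hp, -⟩
  exact absurd hp (Set.notMem_empty p)

end RelFact

/-! ### Permutations that extend injections of finite sets -/

/-- A finite set is smaller than `V`, so the complements of it and of its image are equally large
and can be matched up. -/
theorem Set.Finite.exists_perm_eqOn {V : Type*} [Infinite V] {s : Set V} (hs : s.Finite)
    {f : V → V} (hf : s.InjOn f) : ∃ π : Equiv.Perm V, s.EqOn π f := by
  obtain ⟨g, hg⟩ := Cardinal.extend_function_of_lt (s := s) (⟨fun x => f x, fun x y h =>
    Subtype.ext (hf x.2 y.2 h)⟩ : s ↪ V)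
    ((Cardinal.lt_aleph0_iff_set_finite.2 hs).trans_le (Cardinal.aleph0_le_mk V))
    ⟨Equiv.refl V⟩
  exact ⟨g, fun x hx => hg ⟨x, hx⟩⟩

/-- Some permutation fixes a finite set `A` pointwise and moves the other elements of a finite set
`B` away from a finite set `C`. -/
theorem Set.Finite.exists_perm_avoid {V : Type*} [Infinite V] {A B C : Set V} (hA : A.Finite)
    (hB : B.Finite) (hC : C.Finite) :
    ∃ π : Equiv.Perm V, (∀ x ∈ A, π x = x) ∧ ∀ x ∈ B, x ∉ A → π x ∉ A ∪ C := by
  classical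
  obtain ⟨e⟩ : Nonempty (B ↪ ((A ∪ C)ᶜ : Set V)) := by
    have : Finite B := hB
    have : Infinite ((A ∪ C)ᶜ : Set V) := (hA.union hC).infinite_compl.to_subtype
    exact ⟨(Function.Embedding.trans (Finite.equivFin B).toEmbedding
      (Fin.valEmbedding.trans (_root_.Infinite.natEmbedding _)))⟩
  -- Only the elements of `B` outside `A` are moved, injectively, into the complement of `A ∪ C`.
  let f : V → V := fun x => if hx : x ∈ A then x else if hx : x ∈ B then e ⟨x, hx⟩ else x
  have hfA : ∀ x ∈ A, f x = x := fun x hx => by simp [f, hx]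
  have hfB : ∀ x (hx : x ∈ B), x ∉ A → f x = e ⟨x, hx⟩ := fun x hx hxA => by simp [f, hx, hxA]
  have hf : (A ∪ B).InjOn f := by
    intro x hx y hy hxy
    by_cases hxA : x ∈ A <;> by_cases hyA : y ∈ A
    · rwa [hfA x hxA, hfA y hyA] at hxy
    · rw [hfA x hxA, hfB y (hy.resolve_left hyA) hyA] at hxy
      exact absurd (Or.inl (hxy ▸ hxA)) (e ⟨y, hy.resolve_left hyA⟩).2
    · rw [hfA y hyA, hfB x (hx.resolve_left hxA) hxA] at hxy
      exact absurd (Or.inl (hxy ▸ hyA)) (e ⟨x, hx.resolve_left hxA⟩).2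
    · rw [hfB x (hx.resolve_left hxA) hxA, hfB y (hy.resolve_left hyA) hyA] at hxy
      exact congrArg Subtype.val (e.injective (Subtype.ext hxy))
  obtain ⟨π, hπ⟩ := (hA.union hB).exists_perm_eqOn hf
  refine ⟨π, fun x hx => (hπ (Or.inl hx)).trans (hfA x hx), fun x hx hxA => ?_⟩
  rw [hπ (Or.inr hx), hfB x hx hxA]
  exact (e ⟨x, hx⟩).2

/-! ### The facts of a structure -/

namespace RelStr

open RelFact

variable {R : Type u} {ar : R → ℕ} {V : Type v} {W : Type w}

/-- The facts of a structure. -/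
def facts (S : RelStr ar V) : Set (RelFact ar V) := {p | p.2 ∈ S.interp p.1}

theorem supp_facts (S : RelStr ar V) : RelFact.supp S.facts = S.supp := by
  ext x
  constructor
  · rintro ⟨p, hp, i, hi⟩
    exact ⟨p.1, p.2, hp, i, hi⟩
  · rintro ⟨r, t, hp, i, hi⟩
    exact ⟨⟨r, t⟩, hp, i, hi⟩

theorem facts_finite [Finite R] (S : RelStr ar V) : S.facts.Finite := by
  have : S.facts = ⋃ r, (fun t => (⟨r, t⟩ : RelFact ar V)) '' S.interp r := by
    ext ⟨r, t⟩
    simp only [Set.mem_iUnion, Set.mem_image]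
    constructor
    · exact fun h => ⟨r, t, h, rfl⟩
    · rintro ⟨r', t', h, heq⟩
      cases heq
      exact h
  rw [this]
  exact Set.finite_iUnion fun r => (S.interp_finite r).image _

theorem supp_subset_univ (S : RelStr ar V) : S.supp ⊆ S.univ := by
  rintro _ ⟨r, t, ht, i, rfl⟩
  exact S.interp_mem r t ht i

theorem infinite (S : RelStr ar V) : Infinite V :=
  Set.infinite_univ_iff.1 (S.univ_infinite.mono (Set.subset_univ _))

theorem eq_of_facts_eq {S T : RelStr ar V} (hU : S.univ = T.univ) (h : S.facts = T.facts) :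
    S = T := by
  refine RelStr.ext hU ?_
  funext r
  ext t
  exact Set.ext_iff.1 h ⟨r, t⟩

theorem facts_of_interp_eq_image {S : RelStr ar V} {T : RelStr ar W} {f : V → W}
    (h : ∀ r, T.interp r = (fun t : Fin (ar r) → V => f ∘ t) '' S.interp r) :
    T.facts = RelFact.rename f '' S.facts := by
  ext ⟨r, t⟩
  change t ∈ T.interp r ↔ _
  rw [h r]
  constructor
  · rintro ⟨t', ht', rfl⟩
    exact ⟨⟨r, t'⟩, ht', rfl⟩
  · rintro ⟨⟨r', t'⟩, ht', heq⟩
    cases heq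
    exact ⟨t', ht', rfl⟩

/-- The copy of a structure under an injective renaming. -/
def map (S : RelStr ar V) (f : V → W) (hf : Function.Injective f) : RelStr ar W where
  univ := f '' S.univ
  univ_infinite := S.univ_infinite.image hf.injOn
  interp r := (fun t : Fin (ar r) → V => f ∘ t) '' S.interp r
  interp_finite r := (S.interp_finite r).image _
  interp_mem r := by
    rintro _ ⟨t, ht, rfl⟩ i
    exact ⟨t i, S.interp_mem r t ht i, rfl⟩

theorem iso_map (S : RelStr ar V) {f : V → W} (hf : Function.Injective f) :
    Iso S (S.map f hf) :=
  ⟨f, hf.injOn.bijOn_image, fun _ => rfl⟩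

theorem facts_map (S : RelStr ar V) {f : V → W} (hf : Function.Injective f) :
    (S.map f hf).facts = RelFact.rename f '' S.facts :=
  facts_of_interp_eq_image fun _ => rfl

theorem facts_comp (S T : RelStr ar V) : (comp S T).facts = S.facts ∪ T.facts := rfl

theorem facts_quot (S : RelStr ar V) (s : Setoid V) (h) :
    (S.quot s h).facts = RelFact.rename (Quotient.mk s) '' S.facts :=
  facts_of_interp_eq_image fun _ => rfl

end RelStr

/-! ### Sets of facts glued from the structures in a given set -/

namespace RelFact

variable {R : Type u} {ar : R → ℕ} {V : Type v} {W : Type w}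

/-- The sets of facts obtained from copies of the structures in `𝒮` by forming unions of disjoint
sets of facts whose supports meet. -/
inductive Glue (𝒮 : Set (RelStr ar V)) : Set (RelFact ar V) → Prop
  | base (S : RelStr ar V) (π : Equiv.Perm V) : S ∈ 𝒮 → Glue 𝒮 (rename π '' S.facts)
  | union (F G : Set (RelFact ar V)) : Glue 𝒮 F → Glue 𝒮 G → (supp F ∩ supp G).Nonempty →
      Disjoint F G → Glue 𝒮 (F ∪ G)

variable {𝒮 : Set (RelStr ar V)} {F G : Set (RelFact ar V)}

theorem Glue.finite [Finite R] (h : Glue 𝒮 F) : F.Finite := by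
  induction h with
  | base S π _ => exact S.facts_finite.image _
  | union F G _ _ _ _ hF hG => exact hF.union hG

theorem Glue.infinite (h : Glue 𝒮 F) : Infinite V := by
  induction h with
  | base S _ _ => exact S.infinite
  | union _ _ _ _ _ _ hF _ => exact hF

theorem Glue.of_mem {S : RelStr ar V} (hS : S ∈ 𝒮) : Glue 𝒮 S.facts := by
  have h := Glue.base S (Equiv.refl V) hS
  rwa [image_rename_of_fixed (f := Equiv.refl V) (fun _ _ => rfl)] at h

theorem Glue.rename_perm (h : Glue 𝒮 F) (ρ : Equiv.Perm V) : Glue 𝒮 (rename ρ '' F) := by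
  induction h with
  | base S π hS =>
    have := Glue.base S (π.trans ρ) hS
    rwa [Equiv.coe_trans, show (rename (ρ ∘ π) : RelFact ar V → _) = rename ρ ∘ rename π from rfl,
      Set.image_comp] at this
  | union F G _ _ hne hd hF hG =>
    rw [Set.image_union]
    refine Glue.union _ _ hF hG ?_ ((Set.disjoint_image_iff (injective_rename ρ.injective)).2 hd)
    obtain ⟨x, hxF, hxG⟩ := hne
    rw [supp_rename, supp_rename]
    exact ⟨ρ x, ⟨x, hxF, rfl⟩, ⟨x, hxG, rfl⟩⟩

/-- The supports are finite, so injectivity there is enough: some permutation does the same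
renaming. -/
theorem Glue.rename [Finite R] (h : Glue 𝒮 F) {f : V → V} (hf : (supp F).InjOn f) :
    Glue 𝒮 (rename f '' F) := by
  have := h.infinite
  obtain ⟨π, hπ⟩ := (finite_supp h.finite).exists_perm_eqOn hf
  rw [← image_rename_congr hπ]
  exact h.rename_perm π

end RelFact

/-! ### External fusion versus gluing of sets of facts -/

namespace RelStr

open RelFact

variable {R : Type u} {ar : R → ℕ} {V : Type v} {W : Type w}

/-- No two pairs of a matching can be chained, because they share no element and the two sides are
disjoint. So the classes have at most two elements, and the quotient is injective on either side. -/
theorem IsMatching.eq_or_of_eqvGen {A B : Set V} {M : Set (V × V)} (hM : IsMatching A B M)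
    (hAB : A ∩ B = ∅) {x y : V} (h : Relation.EqvGen (fun a b => (a, b) ∈ M) x y) :
    x = y ∨ (x, y) ∈ M ∨ (y, x) ∈ M := by
  have hno : ∀ a b c, (a, b) ∈ M → (b, c) ∈ M → False := fun a b c h1 h2 =>
    Set.notMem_empty b (hAB ▸ ⟨(hM.1 h2).1, (hM.1 h1).2⟩)
  have hl : ∀ a b c, (a, b) ∈ M → (c, b) ∈ M → a = c := by
    intro a b c h1 h2
    by_contra hne
    have := hM.2 _ h1 _ h2 (fun h => hne (congrArg Prod.fst h))
    exact Set.notMem_empty b (this ▸ ⟨Or.inr rfl, Or.inr rfl⟩)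
  have hr : ∀ a b c, (a, b) ∈ M → (a, c) ∈ M → b = c := by
    intro a b c h1 h2
    by_contra hne
    have := hM.2 _ h1 _ h2 (fun h => hne (congrArg Prod.snd h))
    exact Set.notMem_empty a (this ▸ ⟨Or.inl rfl, Or.inl rfl⟩)
  induction h with
  | rel x y h => exact Or.inr (Or.inl h)
  | refl x => exact Or.inl rfl
  | symm x y _ ih => exact ih.imp Eq.symm Or.symm
  | trans x y z _ _ h1 h2 =>
    rcases h1 with rfl | h1 | h1
    · exact h2
    · rcases h2 with rfl | h2 | h2
      · exact Or.inr (Or.inl h1)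
      · exact (hno _ _ _ h1 h2).elim
      · exact Or.inl (hl _ _ _ h1 h2)
    · rcases h2 with rfl | h2 | h2
      · exact Or.inr (Or.inr h1)
      · exact Or.inl (hr _ _ _ h1 h2)
      · exact (hno _ _ _ h2 h1).elim

variable [Finite R] {𝒮 : Set (RelStr ar V)}

theorem Iso.glue {S T : RelStr ar V} (h : Iso S T) (hS : Glue 𝒮 S.facts) : Glue 𝒮 T.facts := by
  obtain ⟨f, hf, hST⟩ := h
  rw [facts_of_interp_eq_image hST]
  refine hS.rename (hf.injOn.mono ?_)
  rw [supp_facts]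
  exact S.supp_subset_univ

/-- The quotient map renames each of the two parts injectively, a matched pair gives a common
element, and compatibility says that no fact of one part is identified with a fact of the other. -/
theorem glue_of_mem_fusionClosure (har : ∀ r, 1 ≤ ar r) {S : RelStr ar V}
    (hS : S ∈ fusionClosure 𝒮) : Glue 𝒮 S.facts := by
  change InFusionClosure 𝒮 S at hS
  induction hS with
  | base S hS => exact Glue.of_mem hS
  | fuse S₁ S₂ S _ _ hf h₁ h₂ =>
    obtain ⟨A, B, hA, hB, hAB, M, hM, ⟨⟨a, b⟩, hab⟩, hc, hex⟩ := hf
    have hA := hA.glue h₁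
    have hB := hB.glue h₂
    set s := Relation.EqvGen.setoid fun a b => (a, b) ∈ M with hs
    obtain ⟨hq, g, hg, hS⟩ := hex
    have hS' := facts_of_interp_eq_image hS
    have hmkA : ∀ x ∈ A.supp, Quotient.mk s x ∈ ((comp A B).quot s hq).univ :=
      fun x hx => ⟨x, Or.inl (A.supp_subset_univ hx), rfl⟩
    have hmkB : ∀ x ∈ B.supp, Quotient.mk s x ∈ ((comp A B).quot s hq).univ :=
      fun x hx => ⟨x, Or.inr (B.supp_subset_univ hx), rfl⟩
    have hnot : ∀ x, x ∈ A.supp → x ∈ B.supp → False := fun x h1 h2 =>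
      Set.notMem_empty x (hAB ▸ ⟨h1, h2⟩)
    have hinjA : (RelFact.supp A.facts).InjOn (g ∘ Quotient.mk s) := by
      rw [supp_facts]
      intro x hx y hy hxy
      have h1 : s x y := Quotient.exact (hg.injOn (hmkA x hx) (hmkA y hy) hxy)
      rcases hM.eq_or_of_eqvGen hAB h1 with h | h | h
      · exact h
      · exact (hnot _ hy (hM.1 h).2).elim
      · exact (hnot _ hx (hM.1 h).2).elim
    have hinjB : (RelFact.supp B.facts).InjOn (g ∘ Quotient.mk s) := by
      rw [supp_facts]
      intro x hx y hy hxy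
      have h1 : s x y := Quotient.exact (hg.injOn (hmkB x hx) (hmkB y hy) hxy)
      rcases hM.eq_or_of_eqvGen hAB h1 with h | h | h
      · exact h
      · exact (hnot _ (hM.1 h).1 hx).elim
      · exact (hnot _ (hM.1 h).1 hy).elim
    rw [facts_quot, ← Set.image_comp, facts_comp, Set.image_union] at hS'
    rw [hS']
    refine Glue.union _ _ (hA.rename hinjA) (hB.rename hinjB) ?_ ?_
    · refine ⟨g (Quotient.mk s a), ?_, ?_⟩
      · change _ ∈ RelFact.supp (rename (g ∘ Quotient.mk s) '' A.facts)
        rw [supp_rename, supp_facts]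
        exact ⟨a, (hM.1 hab).1, rfl⟩
      · change _ ∈ RelFact.supp (rename (g ∘ Quotient.mk s) '' B.facts)
        rw [supp_rename, supp_facts]
        refine ⟨b, (hM.1 hab).2, ?_⟩
        exact congrArg g (Quotient.sound (s := s) (.symm _ _ (.rel _ _ hab)))
    · rw [Set.disjoint_left]
      rintro _ ⟨⟨r, t⟩, ht, rfl⟩ ⟨⟨r', t'⟩, ht', heq⟩
      obtain rfl : r' = r := congrArg Sigma.fst heq
      have hfun : g ∘ Quotient.mk s ∘ t' = g ∘ Quotient.mk s ∘ t := by
        simpa [RelFact.rename, Function.comp_assoc] using heq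
      -- Equal tuples would have a common element, since arities are positive, while the supports
      -- are disjoint.
      have hne : t ≠ t' := by
        rintro rfl
        exact hnot (t ⟨0, har r'⟩) ⟨r', t, ht, _, rfl⟩ ⟨r', t, ht', _, rfl⟩
      obtain ⟨i, hi⟩ := hc r' t (Or.inl ht) t' (Or.inr ht') hne
      refine hi (Quotient.exact (hg.injOn (hmkA _ ⟨r', t, ht, i, rfl⟩)
        (hmkB _ ⟨r', t', ht', i, rfl⟩) (congrFun hfun i).symm))

/-- A union that is already glued is pulled apart: `G` is moved off `F` by `ρ`, and each common
element `x` is matched with `ρ x`. The quotient puts the parts together again, up to a renaming. -/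
theorem exists_fusionClosure_of_glue {F : Set (RelFact ar V)} (hF : Glue 𝒮 F) :
    ∃ S ∈ fusionClosure 𝒮, ∃ f : V → V, S.supp.InjOn f ∧ F = RelFact.rename f '' S.facts := by
  classical
  induction hF with
  | base S π hS => exact ⟨S, .base S hS, π, π.injective.injOn, rfl⟩
  | union F G hF hG hne hd ihF ihG =>
    obtain ⟨S₁, hS₁, f₁, hf₁, rfl⟩ := ihF
    obtain ⟨S₂, hS₂, f₂, hf₂, rfl⟩ := ihG
    have := hF.infinite
    -- Copies of structures are taken along maps that are injective on all of `V`, so the renamings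
    -- are replaced by permutations that agree with them on the supports.
    obtain ⟨π₁, hπ₁⟩ := S₁.supp_finite.exists_perm_eqOn hf₁
    obtain ⟨π₂, hπ₂⟩ := S₂.supp_finite.exists_perm_eqOn hf₂
    rw [← supp_facts] at hπ₁ hπ₂
    rw [← image_rename_congr hπ₁] at *
    rw [← image_rename_congr hπ₂] at *
    set F := RelFact.rename π₁ '' S₁.facts with hFdef
    set G := RelFact.rename π₂ '' S₂.facts with hGdef
    have hAF : (S₁.map π₁ π₁.injective).facts = F := facts_map _ _
    clear_value F G
    obtain ⟨ρ, -, hρ⟩ := Set.finite_empty.exists_perm_avoid (finite_supp hG.finite)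
      (finite_supp hF.finite)
    replace hρ : ∀ x ∈ RelFact.supp G, ρ x ∉ RelFact.supp F := fun x hx h => hρ x hx (Set.notMem_empty x) (Or.inr h)
    let A := S₁.map π₁ π₁.injective
    let B := S₂.map (π₂.trans ρ) (π₂.trans ρ).injective
    replace hAF : A.facts = F := hAF
    have hBG : B.facts = RelFact.rename ρ '' G := by
      rw [hGdef, ← Set.image_comp]
      exact facts_map _ _
    have hsA : A.supp = RelFact.supp F := by rw [← supp_facts, hAF]
    have hsB : B.supp = ρ '' RelFact.supp G := by rw [← supp_facts, hBG, supp_rename]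
    have hAB : A.supp ∩ B.supp = ∅ := by
      rw [hsA, hsB]
      refine Set.eq_empty_of_forall_notMem ?_
      rintro _ ⟨h1, x, hx, rfl⟩
      exact hρ x hx h1
    let M : Set (V × V) := {p | p.1 ∈ RelFact.supp F ∧ p.1 ∈ RelFact.supp G ∧ p.2 = ρ p.1}
    have hM : IsMatching A.supp B.supp M := by
      constructor
      · rintro ⟨a, b⟩ ⟨h1, h2, h3⟩
        rw [hsA, hsB]
        exact ⟨h1, a, h2, h3.symm⟩
      · rintro ⟨a, b⟩ ⟨ha1, ha2, hb⟩ ⟨c, d⟩ ⟨hc1, hc2, hd⟩ hne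
        obtain rfl : b = ρ a := hb
        obtain rfl : d = ρ c := hd
        have hac : a ≠ c := by
          rintro rfl
          exact hne rfl
        refine Set.eq_empty_of_forall_notMem ?_
        rintro x ⟨rfl | rfl, h | h⟩
        · exact hac h
        · exact hρ c hc2 (Set.mem_of_eq_of_mem (Eq.symm h) ha1)
        · exact hρ a ha2 (Set.mem_of_eq_of_mem h hc1)
        · exact hac (ρ.injective h)
    set s := Relation.EqvGen.setoid fun a b => (a, b) ∈ M with hs
    -- `k` undoes `ρ`. It is constant on the classes of `s`, and on the two supports it separates
    -- them, so it is the renaming from the quotient back to `F ∪ G`.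
    let k : V → V := fun x => if x ∈ ρ '' RelFact.supp G then ρ.symm x else x
    have hkF : ∀ x ∈ RelFact.supp F, k x = x := by
      intro x hx
      refine if_neg ?_
      rintro ⟨y, hy, rfl⟩
      exact hρ y hy hx
    have hkG : ∀ x ∈ RelFact.supp G, k (ρ x) = x := by
      intro x hx
      simp only [k, if_pos (Set.mem_image_of_mem ρ hx), Equiv.symm_apply_apply]
    have hks : ∀ x y, s x y → k x = k y := by
      intro x y h
      induction h with
      | rel x y h =>
        obtain ⟨h1, h2, h3⟩ := h
        simp only at h1 h2 h3
        rw [h3, hkF x h1, hkG x h2]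
      | refl x => rfl
      | symm _ _ _ ih => exact ih.symm
      | trans _ _ _ _ _ h1 h2 => exact h1.trans h2
    have hsk : ∀ x ∈ RelFact.supp F ∪ ρ '' RelFact.supp G, ∀ y ∈ RelFact.supp F ∪ ρ '' RelFact.supp G, k x = k y → s x y := by
      have aux : ∀ x ∈ RelFact.supp F, ∀ y ∈ RelFact.supp G, x = y → s x (ρ y) := by
        rintro x hx _ hy rfl
        exact .rel _ _ ⟨hx, hy, rfl⟩
      rintro x (hx | ⟨x, hx, rfl⟩) y (hy | ⟨y, hy, rfl⟩) hxy
      · rw [hkF x hx, hkF y hy] at hxy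
        exact hxy ▸ s.refl x
      · rw [hkF x hx, hkG y hy] at hxy
        exact aux x hx y hy hxy
      · rw [hkG x hx, hkF y hy] at hxy
        exact s.symm (aux y hy x hx hxy.symm)
      · rw [hkG x hx, hkG y hy] at hxy
        exact hxy ▸ s.refl _
    have hkout : ∀ x, k (Quotient.mk s x).out = k x := fun x => hks _ _ (Quotient.mk_out x)
    have hkFF : RelFact.rename k '' F = F := image_rename_of_fixed hkF
    have hkGG : RelFact.rename k '' (RelFact.rename ρ '' G) = G := by
      rw [← Set.image_comp]
      exact image_rename_of_fixed hkG
    -- `k` fixes all elements outside the finite set `ρ '' supp G`, so infinitely many classes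
    -- remain.
    have hq : (Quotient.mk s '' (comp A B).univ).Infinite := by
      intro hfin
      refine ((comp A B).univ_infinite.sdiff ((finite_supp hG.finite).image ρ)) ?_
      refine (hfin.image fun q => k q.out).subset ?_
      rintro x ⟨hx, hx'⟩
      refine ⟨_, ⟨x, hx, rfl⟩, ?_⟩
      simp only [hkout]
      exact if_neg hx'
    -- Representatives of the classes bring the quotient back into the ambient type `V`.
    let S := ((comp A B).quot s hq).map Quotient.out Quotient.out_injective
    have hSf : S.facts = RelFact.rename Quotient.out '' (RelFact.rename (Quotient.mk s) ''
        (F ∪ RelFact.rename ρ '' G)) := by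
      rw [facts_map, facts_quot, facts_comp, hAF, hBG]
    have hSs : S.supp = Quotient.out '' (Quotient.mk s '' (RelFact.supp F ∪ ρ '' RelFact.supp G)) := by
      rw [← supp_facts, hSf, supp_rename, supp_rename, supp_union, supp_rename]
    refine ⟨S, .fuse S₁ S₂ S hS₁ hS₂ ⟨A, B, iso_map _ _, iso_map _ _, hAB, M, hM, ?_, ?_, hq,
      iso_map _ _⟩, k, ?_, ?_⟩
    · obtain ⟨x, h1, h2⟩ := hne
      exact ⟨(x, ρ x), h1, h2, rfl⟩
    · intro r t ht t' ht' hne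
      by_contra! hno
      have hkt : RelFact.rename k ⟨r, t⟩ = RelFact.rename k ⟨r, t'⟩ := by
        refine congrArg (Sigma.mk r) (funext fun i => hks _ _ (hno i))
      have aux : ∀ t t', t ∈ A.interp r → t' ∈ B.interp r →
          RelFact.rename k ⟨r, t⟩ = RelFact.rename k ⟨r, t'⟩ → False := by
        intro t t' ht ht' hkt
        have h1 : (⟨r, t⟩ : RelFact ar V) ∈ F := hAF ▸ ht
        have h2 : (⟨r, t'⟩ : RelFact ar V) ∈ RelFact.rename ρ '' G := hBG ▸ ht'
        have e1 := Set.mem_image_of_mem (RelFact.rename k) h1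
        have e2 := Set.mem_image_of_mem (RelFact.rename k) h2
        rw [hkFF] at e1
        rw [hkGG, ← hkt] at e2
        exact Set.disjoint_left.1 hd e1 e2
      rcases ht with ht | ht <;> rcases ht' with ht' | ht'
      · have h1 : (⟨r, t⟩ : RelFact ar V) ∈ F := hAF ▸ ht
        have h2 : (⟨r, t'⟩ : RelFact ar V) ∈ F := hAF ▸ ht'
        have := injOn_rename (f := k) (F := F)
          (fun x hx y hy h => by rwa [hkF x hx, hkF y hy] at h) h1 h2 hkt
        exact hne (by simpa using this)
      · exact aux _ _ ht ht' hkt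
      · exact aux _ _ ht' ht hkt.symm
      · have h1 : (⟨r, t⟩ : RelFact ar V) ∈ RelFact.rename ρ '' G := hBG ▸ ht
        have h2 : (⟨r, t'⟩ : RelFact ar V) ∈ RelFact.rename ρ '' G := hBG ▸ ht'
        have := injOn_rename (f := k) (F := RelFact.rename ρ '' G) (by
          rw [supp_rename]
          rintro _ ⟨x, hx, rfl⟩ _ ⟨y, hy, rfl⟩ h
          rw [hkG x hx, hkG y hy] at h
          rw [h]) h1 h2 hkt
        exact hne (by simpa using this)
    · rw [hSs]
      rintro _ ⟨_, ⟨x, hx, rfl⟩, rfl⟩ _ ⟨_, ⟨y, hy, rfl⟩, rfl⟩ hxy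
      rw [hkout, hkout] at hxy
      exact congrArg _ (Quotient.sound (hsk x hx y hy hxy))
    · rw [hSf, ← Set.image_comp, ← Set.image_comp]
      have : (RelFact.rename k ∘ RelFact.rename Quotient.out) ∘ RelFact.rename (Quotient.mk s) =
          (RelFact.rename k : RelFact ar V → RelFact ar V) := by
        funext p
        exact congrArg (Sigma.mk p.1) (funext fun i => hkout (p.2 i))
      rw [this, Set.image_union, hkFF, hkGG]

end RelStr

/-! ### Treewidth of structures and of sets of facts -/

namespace RelStr

open RelFact

variable {R : Type u} {ar : R → ℕ} {V : Type v}

theorem neg_one_le_width {S : RelStr ar V} (T : S.TreeDecomposition) : -1 ≤ T.width := by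
  unfold TreeDecomposition.width
  have := Int.natCast_nonneg (@Finset.sup _ _ _ _ (@Finset.univ _ T.fintypeNode)
    fun n => (T.bag n).card)
  omega

/-- Here `k` bounds the size of a bag, hence the shift by one. Bags of a structure may contain
elements outside the support, whose nodes need not be connected; these elements are removed. -/
theorem hasTreeDec_of_width {S : RelStr ar V} (T : S.TreeDecomposition) {k : ℕ}
    (h : T.width ≤ k - 1) : RelFact.HasTreeDec S.facts k := by
  let fN := T.fintypeNode
  have hcard : ∀ n, (T.bag n).card ≤ k := by
    intro n
    have h1 := Finset.le_sup (f := fun n => (T.bag n).card) (Finset.mem_univ n)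
    change (((Finset.univ.sup fun n => (T.bag n).card : ℕ) : ℤ) - 1) ≤ (k : ℤ) - 1 at h
    have h2 : (Finset.univ.sup fun n => (T.bag n).card) ≤ k := by omega
    exact h1.trans h2
  classical
  refine ⟨T.Node, inferInstance, T.tree, fun n => (T.bag n).filter (· ∈ S.supp), T.isTree,
    ?_, ?_, ?_, fun n => (Finset.card_filter_le _ _).trans (hcard n)⟩
  · intro n x hx
    rw [supp_facts]
    exact (Finset.mem_filter.1 hx).2
  · rintro _ ⟨⟨r, t⟩, ht, rfl⟩
    obtain ⟨n, hn⟩ := T.tuple_covered r t ht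
    refine ⟨n, ?_⟩
    rintro _ ⟨i, rfl⟩
    exact Finset.mem_filter.2 ⟨hn i, r, t, ht, i, rfl⟩
  · intro x hx
    rw [supp_facts] at hx
    have : {n | x ∈ (T.bag n).filter (· ∈ S.supp)} = {n | x ∈ T.bag n} := by
      ext n
      simp [hx]
    rw [this]
    exact T.elem_connected x hx

theorem exists_width_le {S : RelStr ar V} {k : ℕ} (h : RelFact.HasTreeDec S.facts k) :
    ∃ T : S.TreeDecomposition, T.width ≤ k - 1 := by
  obtain ⟨N, fN, T, bag, hT, hP, hH, hc, hk⟩ := h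
  have := Fintype.ofFinite N
  obtain ⟨a⟩ := hT.connected.nonempty
  refine ⟨{ Node := N, tree := T, isTree := hT, root := a, bag := bag, bag_subset := ?_,
            tuple_covered := ?_, elem_connected := ?_ }, ?_⟩
  · intro n
    refine (hP n).trans ?_
    rw [supp_facts]
    exact S.supp_subset_univ
  · intro r t ht
    obtain ⟨n, hn⟩ := hH _ ⟨⟨r, t⟩, ht, rfl⟩
    exact ⟨n, fun i => hn ⟨i, rfl⟩⟩
  · intro x hx
    rw [← supp_facts] at hx
    exact hc x hx
  · change (((Finset.univ.sup fun n => (bag n).card : ℕ) : ℤ) - 1) ≤ (k : ℤ) - 1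
    have : (Finset.univ.sup fun n => (bag n).card) ≤ k := Finset.sup_le fun n _ => hk n
    omega

theorem bddBelow_width (S : RelStr ar V) :
    BddBelow (Set.range fun T : S.TreeDecomposition => T.width) :=
  ⟨-1, by rintro _ ⟨T, rfl⟩; exact neg_one_le_width T⟩

theorem nonempty_width [Finite R] (S : RelStr ar V) :
    (Set.range fun T : S.TreeDecomposition => T.width).Nonempty := by
  obtain ⟨X, hX⟩ := S.supp_finite.exists_finset_coe
  have h : RelFact.HasTreeDec S.facts X.card := by
    have h := _root_.HasTreeDec.of_finite (X := X) le_rfl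
    rw [hX, ← supp_facts] at h
    refine h.mono ?_ le_rfl
    rintro _ ⟨p, hp, rfl⟩
    exact ⟨_, rfl, range_subset_supp hp⟩
  obtain ⟨T, -⟩ := exists_width_le h
  exact ⟨_, T, rfl⟩

theorem treewidth_le_iff [Finite R] (S : RelStr ar V) (k : ℕ) :
    S.treewidth ≤ k - 1 ↔ RelFact.HasTreeDec S.facts k := by
  constructor
  · intro h
    obtain ⟨T, hT⟩ := Int.csInf_mem S.nonempty_width S.bddBelow_width
    exact hasTreeDec_of_width T (hT.le.trans h)
  · intro h
    obtain ⟨T, hT⟩ := exists_width_le h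
    exact (csInf_le S.bddBelow_width ⟨T, rfl⟩).trans hT

theorem neg_one_le_treewidth [Finite R] (S : RelStr ar V) : -1 ≤ S.treewidth := by
  refine le_csInf S.nonempty_width ?_
  rintro _ ⟨T, rfl⟩
  exact neg_one_le_width T

theorem treewidthBounded_iff [Finite R] {𝒮 : Set (RelStr ar V)} :
    TreewidthBounded 𝒮 ↔ ∃ k : ℕ, ∀ S ∈ 𝒮, RelFact.HasTreeDec S.facts k := by
  constructor
  · intro h
    obtain ⟨b, hb⟩ := h.bddAbove
    -- Treewidths are at least `-1`, so `b + 1` is nonnegative as soon as there is a structure, and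
    -- no bound is lost by truncation.
    refine ⟨(b + 1).toNat, fun S hS => (treewidth_le_iff S _).1 ?_⟩
    have := hb ⟨S, hS, rfl⟩
    have := neg_one_le_treewidth S
    omega
  · rintro ⟨k, hk⟩
    refine (Set.finite_Icc (-1 : ℤ) (k - 1)).subset ?_
    rintro _ ⟨S, hS, rfl⟩
    exact ⟨neg_one_le_treewidth S, (treewidth_le_iff S k).2 (hk S hS)⟩

theorem treewidthBounded_fusionClosure_iff [Finite R] (har : ∀ r, 1 ≤ ar r)
    {𝒮 : Set (RelStr ar V)} :
    TreewidthBounded (fusionClosure 𝒮) ↔ ∃ k : ℕ, ∀ F, Glue 𝒮 F → RelFact.HasTreeDec F k := by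
  rw [treewidthBounded_iff]
  refine exists_congr fun k => ⟨fun h F hF => ?_, fun h S hS =>
    h _ (glue_of_mem_fusionClosure har hS)⟩
  obtain ⟨S, hS, f, hf, rfl⟩ := exists_fusionClosure_of_glue hF
  refine (h S hS).rename ?_
  rwa [supp_facts]

/-! ### Maximally connected substructures and components -/

theorem HasPath.link {S : RelStr ar V} {x y : V} (h : S.HasPath x y) : Link S.facts x y := by
  obtain ⟨k, p, hp, hx, hy, hc⟩ := h
  have key : ∀ i : Fin (k + 1), ∀ z ∈ Set.range (p i).2, Link S.facts x z := by
    intro i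
    induction i using Fin.induction with
    | zero => exact fun z hz => link_of_mem (hp 0) hx hz
    | succ i ih =>
      intro z hz
      obtain ⟨w, hw1, hw2⟩ := hc i
      exact (ih w hw1).trans (link_of_mem (hp i.succ) hw2 hz)
  exact key _ y hy

theorem hasPath_of_link {S : RelStr ar V} {x y : V} (hx : x ∈ S.supp) (h : Link S.facts x y) :
    S.HasPath x y := by
  induction h with
  | refl =>
    obtain ⟨r, t, ht, i, hi⟩ := hx
    exact ⟨0, fun _ => ⟨r, t⟩, fun _ => ht, ⟨i, hi⟩, ⟨i, hi⟩, fun i => i.elim0⟩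
  | tail _ h ih =>
    obtain ⟨q, hq, h1, h2⟩ := h
    obtain ⟨k, p, hp, hx, hy, hc⟩ := ih
    refine ⟨k + 1, Fin.snoc (α := fun _ => RelFact ar V) p q, fun i => ?_, ?_, ?_, fun i => ?_⟩
    · induction i using Fin.lastCases with
      | last => rw [Fin.snoc_last]; exact hq
      | cast i => rw [Fin.snoc_castSucc]; exact hp i
    · have : (Fin.snoc (α := fun _ => RelFact ar V) p q : Fin (k + 2) → RelFact ar V) 0 = p 0 :=
        Fin.snoc_castSucc (α := fun _ => RelFact ar V) (x := q) (p := p) (i := 0)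
      rw [this]
      exact hx
    · rw [Fin.snoc_last]
      exact h2
    · rw [Fin.snoc_castSucc]
      induction i using Fin.lastCases with
      | last =>
        rw [Fin.succ_last, Fin.snoc_last]
        exact ⟨_, hy, h1⟩
      | cast i =>
        rw [Fin.succ_castSucc, Fin.snoc_castSucc]
        exact hc i

theorem isConnected_iff (S : RelStr ar V) : S.IsConnected ↔ Linked S.facts := by
  unfold IsConnected Linked
  rw [supp_facts]
  exact forall₂_congr fun x hx => forall₂_congr fun y _ =>
    ⟨HasPath.link, hasPath_of_link hx⟩

theorem isSubstructure_iff {S T : RelStr ar V} :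
    S.IsSubstructure T ↔ S.univ ⊆ T.univ ∧
      S.facts = {p ∈ T.facts | Set.range p.2 ⊆ S.supp} := by
  refine and_congr_right fun _ => ⟨fun h => ?_, fun h r => ?_⟩
  · ext ⟨r, t⟩
    rw [Set.mem_ofPred_eq, Set.range_subset_iff]
    exact Set.ext_iff.1 (h r) t
  · ext t
    have := Set.ext_iff.1 h ⟨r, t⟩
    rw [Set.mem_ofPred_eq, Set.range_subset_iff] at this
    exact this

/-- The substructure with the same universe and with the given facts. -/
def withFacts [Finite R] (T : RelStr ar V) (F : Set (RelFact ar V)) (h : F ⊆ T.facts) :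
    RelStr ar V where
  univ := T.univ
  univ_infinite := T.univ_infinite
  interp r := {t | (⟨r, t⟩ : RelFact ar V) ∈ F}
  interp_finite r := (T.interp_finite r).subset fun _ ht => h ht
  interp_mem r t ht := T.interp_mem r t (h ht)

theorem facts_withFacts [Finite R] (T : RelStr ar V) (F : Set (RelFact ar V))
    (h : F ⊆ T.facts) : (T.withFacts F h).facts = F := rfl

variable [Finite R]

theorem component_withFacts_isSubstructure (T : RelStr ar V) {x : V} (hx : x ∈ T.supp) :
    (T.withFacts (component T.facts x) component_subset).IsSubstructure T := by
  rw [isSubstructure_iff]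
  refine ⟨subset_rfl, ?_⟩
  rw [← supp_facts, facts_withFacts, supp_component (by rwa [supp_facts])]
  rfl

/-- The order on substructures also compares universes, so the component is given the whole universe
of `T`. Connected facts containing the component cannot reach beyond it. -/
theorem component_withFacts_isMaxConnSubstructure (T : RelStr ar V) {x : V} (hx : x ∈ T.supp) :
    (T.withFacts (component T.facts x) component_subset).IsMaxConnSubstructure T := by
  have hx' : x ∈ RelFact.supp T.facts := by rwa [supp_facts]
  refine ⟨component_withFacts_isSubstructure T hx, ?_, fun S' h1 h2 h3 => ?_⟩
  · rw [isConnected_iff]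
    exact linked_component hx'
  · rw [isSubstructure_iff] at h1 h3
    refine eq_of_facts_eq (subset_antisymm h3.1 h1.1) ?_
    rw [isConnected_iff] at h2
    have hsub : component T.facts x ⊆ S'.facts := by
      have := h3.2
      rw [facts_withFacts] at this
      rw [this]
      exact fun p hp => hp.1
    have hx'' : x ∈ RelFact.supp S'.facts :=
      supp_mono hsub (by rw [supp_component hx']; exact .refl)
    refine subset_antisymm hsub fun p hp => ?_
    have hpT : p ∈ T.facts := (h1.2 ▸ hp :).1
    refine ⟨hpT, fun y hy => (h2 x hx'' y (range_subset_supp hp hy)).mono ?_⟩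
    intro q hq
    exact (h1.2 ▸ hq :).1

variable {𝒮 : Set (RelStr ar V)}

theorem component_mem_split {T : RelStr ar V} (hT : T ∈ 𝒮) {x : V} (hx : x ∈ T.supp) :
    ∃ S ∈ split 𝒮, S.facts = component T.facts x :=
  ⟨_, ⟨T, hT, component_withFacts_isMaxConnSubstructure T hx⟩, rfl⟩

/-- A maximally connected substructure consists of all facts that meet its support. -/
theorem exists_of_mem_split {S : RelStr ar V} (hS : S ∈ split 𝒮) :
    ∃ T ∈ 𝒮, S.facts ⊆ T.facts ∧ Linked S.facts ∧
      ∀ p ∈ T.facts, ∀ x ∈ Set.range p.2, x ∈ RelFact.supp S.facts → p ∈ S.facts := by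
  obtain ⟨T, hT, hsub, hconn, hmax⟩ := hS
  have hsub' := isSubstructure_iff.1 hsub
  have hST : S.facts ⊆ T.facts := by
    intro p hp
    exact (hsub'.2 ▸ hp :).1
  have hlink := (isConnected_iff S).1 hconn
  refine ⟨T, hT, hST, hlink, fun p hp x hxp hx => ?_⟩
  have hxT : x ∈ T.supp := by
    rw [← supp_facts]
    exact supp_mono hST hx
  have hSC : S.IsSubstructure (T.withFacts (component T.facts x) component_subset) := by
    rw [isSubstructure_iff]
    refine ⟨hsub'.1, Set.ext fun q => ⟨fun hq => ⟨⟨hST hq, fun y hy => ?_⟩, ?_⟩, fun hq => ?_⟩⟩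
    · exact (hlink x hx y (range_subset_supp hq hy)).mono hST
    · rw [← supp_facts]
      exact range_subset_supp hq
    · rw [hsub'.2]
      exact ⟨hq.1.1, hq.2⟩
  have := hmax _ (component_withFacts_isSubstructure T hxT)
    (component_withFacts_isMaxConnSubstructure T hxT).2.1 hSC
  rw [this, facts_withFacts]
  exact mem_component hp hxp .refl

end RelStr

/-! ### The upper bound on the treewidth -/

namespace RelFact

variable {R : Type u} {ar : R → ℕ} {V : Type v}

/-- A colour misses a family of colours if it is disjoint from some member of the family. -/
def Misses (B : Set (Set R)) (C : Set R) : Prop := ∃ D ∈ B, C ∩ D = ∅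

/-- The elements whose colour neither misses nor belongs to the family `B`. -/
def greens (B : Set (Set R)) (F : Set (RelFact ar V)) : Set V :=
  {x ∈ supp F | ¬ Misses B (colour F x) ∧ colour F x ∉ B}

/-- Exactly one element has a colour that misses `B`, the colours of all others are in `B`. -/
def OneRed (B : Set (Set R)) (F : Set (RelFact ar V)) : Prop :=
  ∃ x ∈ supp F, Misses B (colour F x) ∧ ∀ y ∈ supp F, y ≠ x → colour F y ∈ B

/-- No element has a colour that misses `B`. -/
def NoRed (B : Set (Set R)) (F : Set (RelFact ar V)) : Prop :=
  ∀ x ∈ supp F, ¬ Misses B (colour F x)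

/-- A tree decomposition in which all green elements share a bag. -/
def HasGreenTreeDec (B : Set (Set R)) (F : Set (RelFact ar V)) (k : ℕ) : Prop :=
  _root_.HasTreeDec (supp F) (insert (greens B F) (edges F)) k

variable {B : Set (Set R)} {F G : Set (RelFact ar V)} {k l : ℕ}

theorem HasGreenTreeDec.hasTreeDec (h : HasGreenTreeDec B F k) : HasTreeDec F k :=
  _root_.HasTreeDec.mono_edges h (Set.subset_insert _ _)

theorem HasTreeDec.mono (h : HasTreeDec F k) (hkl : k ≤ l) : HasTreeDec F l :=
  _root_.HasTreeDec.mono h (fun i hi => ⟨i, hi, subset_rfl⟩) hkl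

/-- The green elements are put into every bag. This is affordable only once, for a single structure;
later fusions have to preserve the common bag. -/
theorem HasTreeDec.hasGreenTreeDec [Finite R] (hF : F.Finite) (h : HasTreeDec F k) :
    HasGreenTreeDec B F (k + (greens B F).ncard) := by
  have hfin : (greens B F).Finite := (finite_supp hF).subset fun x hx => hx.1
  obtain ⟨X, hX⟩ := hfin.exists_finset_coe
  have := _root_.HasTreeDec.add_all h (X := X) (by rw [hX]; exact fun x hx => hx.1)
  rw [hX] at this
  rw [← hX, Set.ncard_coe_finset]
  refine this.mono ?_ le_rfl
  rintro i (rfl | hi)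
  · exact ⟨_, Or.inl rfl, subset_rfl⟩
  · exact ⟨_, Or.inr ⟨i, hi, rfl⟩, Set.subset_union_left⟩

theorem HasTreeDec.union_of_inter_subset_singleton (hF : HasTreeDec F k) (hG : HasTreeDec G k)
    {x : V} (hxF : x ∈ supp F) (hxG : x ∈ supp G) (h : supp F ∩ supp G ⊆ {x}) :
    HasTreeDec (F ∪ G) k := by
  unfold HasTreeDec
  rw [supp_union, edges_union]
  refine (_root_.HasTreeDec.join (_root_.HasTreeDec.insert_singleton hF hxF)
    (_root_.HasTreeDec.insert_singleton hG hxG) ⟨_, Or.inl rfl, h⟩ ⟨_, Or.inl rfl, h⟩).mono_edges ?_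
  exact Set.union_subset_union (Set.subset_insert _ _) (Set.subset_insert _ _)

theorem HasTreeDec.union_of_inter_subset_finset (hF : HasTreeDec F k) (hG : HasTreeDec G k)
    {X : Finset V} (hXF : (X : Set V) ⊆ supp F) (hXG : (X : Set V) ⊆ supp G)
    (h : supp F ∩ supp G ⊆ X) : HasTreeDec (F ∪ G) (k + X.card) := by
  unfold HasTreeDec
  rw [supp_union, edges_union]
  refine (_root_.HasTreeDec.join (_root_.HasTreeDec.add_all hF hXF)
    (_root_.HasTreeDec.add_all hG hXG) ⟨_, Or.inl rfl, h⟩ ⟨_, Or.inl rfl, h⟩).mono ?_ le_rfl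
  rintro i (hi | hi)
  · exact ⟨_, Or.inl (Or.inr ⟨i, hi, rfl⟩), Set.subset_union_left⟩
  · exact ⟨_, Or.inr (Or.inr ⟨i, hi, rfl⟩), Set.subset_union_left⟩

theorem HasGreenTreeDec.union_of_inter_subset_singleton (hF : HasGreenTreeDec B F k)
    (hG : HasTreeDec G k) {x : V} (hxF : x ∈ supp F) (hxG : x ∈ supp G)
    (h : supp F ∩ supp G ⊆ {x}) (hgr : greens B (F ∪ G) ⊆ greens B F) :
    HasGreenTreeDec B (F ∪ G) k := by
  unfold HasGreenTreeDec
  rw [supp_union, edges_union]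
  refine (_root_.HasTreeDec.join (_root_.HasTreeDec.insert_singleton hF hxF)
    (_root_.HasTreeDec.insert_singleton hG hxG) ⟨_, Or.inl rfl, h⟩ ⟨_, Or.inl rfl, h⟩).mono ?_ le_rfl
  rintro i (rfl | hi | hi)
  · exact ⟨_, Or.inl (Or.inr (Or.inl rfl)), hgr⟩
  · exact ⟨_, Or.inl (Or.inr (Or.inr hi)), subset_rfl⟩
  · exact ⟨_, Or.inr (Or.inr hi), subset_rfl⟩

/-- A new node, whose bag consists of the green elements of both parts, is placed between the two
trees. Shared elements are green on both sides, so it contains both interfaces. The width stays at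
`k`. -/
theorem HasGreenTreeDec.union (hF : HasGreenTreeDec B F k)
    (hG : HasGreenTreeDec B G k) (hFf : (greens B F).Finite) (hGf : (greens B G).Finite)
    (hk : (greens B F).ncard + (greens B G).ncard ≤ k)
    (h : supp F ∩ supp G ⊆ greens B F ∩ greens B G)
    (hgr : greens B (F ∪ G) ⊆ greens B F ∪ greens B G) : HasGreenTreeDec B (F ∪ G) k := by
  obtain ⟨Y, hY⟩ := (hFf.union hGf).exists_finset_coe
  have hYk : Y.card ≤ k := by
    rw [← Set.ncard_coe_finset, hY]
    exact (Set.ncard_union_le _ _).trans hk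
  have hYD := _root_.HasTreeDec.of_finite hYk
  rw [hY] at hYD
  have h1 := _root_.HasTreeDec.join hF hYD
    ⟨_, Or.inl rfl, fun x hx => hx.2.elim id fun hx2 => (h ⟨hx.1, hx2.1⟩).1⟩
    ⟨_, rfl, Set.inter_subset_right⟩
  have h2 := _root_.HasTreeDec.join h1 hG
    ⟨_, Or.inr rfl, fun x hx => hx.1.elim (fun hx1 => Or.inl (h ⟨hx1, hx.2⟩).1) id⟩
    ⟨_, Or.inl rfl, fun x hx => hx.1.elim (fun hx1 => (h ⟨hx1, hx.2⟩).2) fun hx1 =>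
      hx1.elim (fun hx1 => (h ⟨hx1.1, hx.2⟩).2) id⟩
  unfold HasGreenTreeDec
  rw [supp_union, edges_union]
  have hP : supp F ∪ supp G = supp F ∪ (greens B F ∪ greens B G) ∪ supp G := by
    refine subset_antisymm (Set.union_subset_union_left _ Set.subset_union_left) ?_
    refine Set.union_subset (Set.union_subset Set.subset_union_left ?_) Set.subset_union_right
    exact Set.union_subset_union (fun x hx => hx.1) (fun x hx => hx.1)
  rw [hP]
  refine h2.mono ?_ le_rfl
  rintro i (rfl | hi | hi)
  · exact ⟨_, Or.inl (Or.inr rfl), hgr⟩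
  · exact ⟨_, Or.inl (Or.inl (Or.inr hi)), subset_rfl⟩
  · exact ⟨_, Or.inr (Or.inr hi), subset_rfl⟩

theorem Misses.anti {C D : Set R} (h : Misses B D) (hCD : C ⊆ D) : Misses B C := by
  obtain ⟨E, hE, hDE⟩ := h
  exact ⟨E, hE, Set.eq_empty_of_subset_empty (hDE ▸ Set.inter_subset_inter_left E hCD)⟩

/-- Colours only grow in a union, and `B` is closed upwards. -/
theorem notMem_of_mem_greens_union (hup : ∀ C ∈ B, ∀ D, C ⊆ D → D ∈ B) {x : V}
    (hx : x ∈ greens B (F ∪ G)) : colour F x ∉ B ∧ colour G x ∉ B :=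
  ⟨fun h => hx.2.2 (hup _ h _ Set.subset_union_left),
    fun h => hx.2.2 (hup _ h _ Set.subset_union_right)⟩

/-- The structure of the sets of facts that are glued from structures that conform to a colour
scheme with an intersecting upward closed set `B` of blue colours. -/
theorem Glue.oneRed_or_noRed [Finite R] (har : ∀ r, 1 ≤ ar r)
    (hup : ∀ C ∈ B, ∀ D, C ⊆ D → D ∈ B) (hint : ∀ C ∈ B, ∀ D ∈ B, C ∩ D ≠ ∅)
    {𝒞 : Set (RelStr ar V)} {g : ℕ}
    (hbase : ∀ S ∈ 𝒞, HasTreeDec S.facts k)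
    (hred : ∀ S ∈ 𝒞, OneRed B S.facts ∨ NoRed B S.facts)
    (hgreen : ∀ F, Glue 𝒞 F → (greens B F).ncard ≤ g) (h : Glue 𝒞 F) :
    OneRed B F ∧ HasTreeDec F k ∨
      NoRed B F ∧ HasGreenTreeDec B F (k + 2 + 2 * g) := by
  have hBn : ∀ C ∈ B, ¬ Misses B C := fun C hC ⟨D, hD, hCD⟩ => hint C hC D hD hCD
  induction h with
  | base S π hS =>
    have hinj : (supp S.facts).InjOn π := π.injective.injOn
    have hD := (hbase S hS).rename hinj
    rcases hred S hS with ⟨x, hx, hmx, hy⟩ | hno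
    · refine Or.inl ⟨⟨π x, ?_, ?_, ?_⟩, hD⟩
      · rw [supp_rename]
        exact ⟨x, hx, rfl⟩
      · rwa [colour_rename hinj hx]
      · rw [supp_rename]
        rintro _ ⟨y, hy', rfl⟩ hne
        rw [colour_rename hinj hy']
        exact hy y hy' fun h => hne (congrArg π h)
    · refine Or.inr ⟨?_, ?_⟩
      · intro x hx
        rw [supp_rename] at hx
        obtain ⟨x, hx, rfl⟩ := hx
        rw [colour_rename hinj hx]
        exact hno x hx
      · refine (hD.hasGreenTreeDec (S.facts_finite.image _)).mono
          (fun i hi => ⟨i, hi, subset_rfl⟩) ?_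
        have := hgreen _ (Glue.base S π hS)
        omega
  | union F G hF hG hne hd ihF ihG =>
    -- The parts have no common fact, so their colours at an element are disjoint: blue on one side
    -- means red on the other.
    have hFG : ∀ x, colour F x ∈ B → Misses B (colour G x) := fun x hx =>
      ⟨_, hx, by rw [Set.inter_comm]; exact colour_inter_of_disjoint hd x⟩
    have hGF : ∀ x, colour G x ∈ B → Misses B (colour F x) := fun x hx =>
      ⟨_, hx, colour_inter_of_disjoint hd x⟩
    have hcF : ∀ x, colour F x ⊆ colour (F ∪ G) x := fun x => Set.subset_union_left
    have hcG : ∀ x, colour G x ⊆ colour (F ∪ G) x := fun x => Set.subset_union_right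
    have hgrn : ∀ F, Glue 𝒞 F → (greens B F).Finite := fun F hF =>
      (finite_supp hF.finite).subset fun x hx => hx.1
    have hg := hgreen _ hF
    have hg' := hgreen _ hG
    obtain ⟨z, hzF, hzG⟩ := hne
    -- the fusion of a structure without red elements and one with a single red element
    have mixed : ∀ F G : Set (RelFact ar V), (∀ x, colour G x ∈ B → Misses B (colour F x)) →
        z ∈ supp F → z ∈ supp G → NoRed B F → OneRed B G →
        HasGreenTreeDec B F (k + 2 + 2 * g) → HasTreeDec G k →
        NoRed B (F ∪ G) ∧ HasGreenTreeDec B (F ∪ G) (k + 2 + 2 * g) := by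
      rintro F G hGF hzF hzG hF ⟨x, hx, hmx, hxB⟩ hDF hDG
      -- Any other shared element is blue in `G`, hence red in `F`, which has no red element.
      have hI : ∀ y, y ∈ supp F → y ∈ supp G → y = x := fun y hyF hyG => by
        by_contra hne
        exact hF y hyF (hGF y (hxB y hyG hne))
      obtain rfl := hI z hzF hzG
      refine ⟨fun y hy hm => ?_, hDF.union_of_inter_subset_singleton (hDG.mono (by omega)) hzF hzG
        (fun y hy => hI y hy.1 hy.2) fun y hy => ?_⟩
      · rw [supp_union] at hy
        by_cases hyF : y ∈ supp F
        · exact hF y hyF (hm.anti Set.subset_union_left)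
        · have hyG := hy.resolve_left hyF
          exact hBn _ (hxB y hyG (fun h => hyF (h ▸ hzF))) (hm.anti Set.subset_union_right)
      · have h1 := notMem_of_mem_greens_union hup hy
        have hy' := hy.1
        rw [supp_union] at hy'
        have hyF : y ∈ supp F := by
          by_contra hyF
          exact h1.2 (hxB y (hy'.resolve_left hyF) (fun h => hyF (h ▸ hzF)))
        exact ⟨hyF, hF y hyF, h1.1⟩
    rcases ihF with ⟨hRF, hDF⟩ | ⟨hNF, hDF⟩ <;> rcases ihG with ⟨hRG, hDG⟩ | ⟨hNG, hDG⟩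
    · obtain ⟨x₁, hx₁, hm₁, hB₁⟩ := hRF
      obtain ⟨x₂, hx₂, hm₂, hB₂⟩ := hRG
      -- Any other shared element would be blue on both sides, and blue colours intersect.
      have hI : ∀ y, y ∈ supp F → y ∈ supp G → y = x₁ ∨ y = x₂ := fun y hyF hyG => by
        by_contra! hne
        exact hBn _ (hB₁ y hyF hne.1) (hGF y (hB₂ y hyG hne.2))
      have hother : ∀ y ∈ supp (F ∪ G), y ≠ x₁ → y ≠ x₂ → colour (F ∪ G) y ∈ B := by
        intro y hy h1 h2
        rw [supp_union] at hy
        rcases hy with hy | hy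
        · exact hup _ (hB₁ y hy h1) _ (hcF y)
        · exact hup _ (hB₂ y hy h2) _ (hcG y)
      have hx₁' : x₁ ∈ supp (F ∪ G) := supp_mono Set.subset_union_left hx₁
      have hx₂' : x₂ ∈ supp (F ∪ G) := supp_mono Set.subset_union_right hx₂
      by_cases h12 : x₁ = x₂
      · subst h12
        have hD : HasTreeDec (F ∪ G) k := hDF.union_of_inter_subset_singleton hDG hx₁ hx₂
          fun y hy => (hI y hy.1 hy.2).elim id id
        -- The fused element may stay red, or else it is the only possible green element, so that
        -- any bag containing it will do.
        by_cases hm : Misses B (colour (F ∪ G) x₁)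
        · exact Or.inl ⟨⟨x₁, hx₁', hm, fun y hy h => hother y hy h h⟩, hD⟩
        · refine Or.inr ⟨fun y hy => ?_, ?_⟩
          · by_cases h : y = x₁
            · exact h ▸ hm
            · exact hBn _ (hother y hy h h)
          · refine (_root_.HasTreeDec.insert_singleton hD hx₁').mono ?_ (by omega)
            rintro i (rfl | hi)
            · refine ⟨_, Or.inl rfl, fun y hy => ?_⟩
              by_contra h
              exact hy.2.2 (hother y hy.1 h h)
            · exact ⟨i, Or.inr hi, subset_rfl⟩
      · have hb₁ : x₁ ∈ supp G → colour (F ∪ G) x₁ ∈ B := fun h =>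
          hup _ (hB₂ x₁ h h12) _ (hcG x₁)
        have hb₂ : x₂ ∈ supp F → colour (F ∪ G) x₂ ∈ B := fun h =>
          hup _ (hB₁ x₂ h (Ne.symm h12)) _ (hcF x₂)
        by_cases h1 : x₁ ∈ supp G
        · by_cases h2 : x₂ ∈ supp F
          -- Each red element is fused with a blue one, so everything becomes blue. Two shared
          -- elements cost two more places in the bags, but this happens only on passing from one
          -- red element to none, so the cost is paid once.
          · have hall : ∀ y ∈ supp (F ∪ G), colour (F ∪ G) y ∈ B := by
              intro y hy
              by_cases hy1 : y = x₁
              · exact hy1 ▸ hb₁ h1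
              by_cases hy2 : y = x₂
              · exact hy2 ▸ hb₂ h2
              exact hother y hy hy1 hy2
            classical
            have hD : HasTreeDec (F ∪ G) (k + 2) := by
              rw [← Finset.card_pair h12]
              refine hDF.union_of_inter_subset_finset hDG ?_ ?_ fun y hy => ?_
              · intro y hy
                rcases Finset.mem_insert.1 hy with rfl | hy
                · exact hx₁
                · exact Finset.mem_singleton.1 hy ▸ h2
              · intro y hy
                rcases Finset.mem_insert.1 hy with rfl | hy
                · exact h1
                · exact Finset.mem_singleton.1 hy ▸ hx₂
              · simpa using hI y hy.1 hy.2
            refine Or.inr ⟨fun y hy => hBn _ (hall y hy), ?_⟩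
            refine (_root_.HasTreeDec.insert_empty hD).mono ?_ (by omega)
            rintro i (rfl | hi)
            · exact ⟨_, Or.inl rfl, fun y hy => hy.2.2 (hall y hy.1)⟩
            · exact ⟨i, Or.inr hi, subset_rfl⟩
          -- Only `x₁` is shared, and it turns blue; `x₂` keeps its colour and remains the single
          -- red element.
          · refine Or.inl ⟨⟨x₂, hx₂', ?_, fun y hy hy2 => ?_⟩,
              hDF.union_of_inter_subset_singleton hDG hx₁ h1 fun y hy => ?_⟩
            · rwa [colour_union_right har h2]
            · by_cases hy1 : y = x₁
              · exact hy1 ▸ hb₁ h1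
              · exact hother y hy hy1 hy2
            · exact (hI y hy.1 hy.2).resolve_right fun h => h2 (h ▸ hy.1)
        · have hI' : ∀ y, y ∈ supp F → y ∈ supp G → y = x₂ := fun y hy hy' =>
            (hI y hy hy').resolve_left fun h => h1 (h ▸ hy')
          obtain rfl := hI' z hzF hzG
          refine Or.inl ⟨⟨x₁, hx₁', ?_, fun y hy hy2 => ?_⟩,
              hDF.union_of_inter_subset_singleton hDG hzF hzG fun y hy => hI' y hy.1 hy.2⟩
          · rwa [colour_union_left har h1]
          · by_cases hy1 : y = z
            · exact hy1 ▸ hb₂ hzF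
            · exact hother y hy hy2 hy1
    · rw [Set.union_comm]
      exact Or.inr (mixed G F hFG hzG hzF hNG hRF hDG hDF)
    · exact Or.inr (mixed F G hGF hzF hzG hNF hRG hDF hDG)
    -- Shared elements are green on both sides. The green elements of both number at most `2 * g`,
    -- and so fit into one bag.
    · refine Or.inr ⟨fun x hx hm => ?_, hDF.union hDG (hgrn F hF) (hgrn G hG) (by omega)
        (fun x hx => ?_) fun x hx => ?_⟩
      · rw [supp_union] at hx
        rcases hx with hx | hx
        · exact hNF x hx (hm.anti (hcF x))
        · exact hNG x hx (hm.anti (hcG x))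
      · exact ⟨⟨hx.1, hNF x hx.1, fun h => hNG x hx.2 (hFG x h)⟩,
          ⟨hx.2, hNG x hx.2, fun h => hNF x hx.1 (hGF x h)⟩⟩
      · have h1 := notMem_of_mem_greens_union hup hx
        have hx' := hx.1
        rw [supp_union] at hx'
        exact hx'.imp (fun h => ⟨h, hNF x h, h1.1⟩) fun h => ⟨h, hNG x h, h1.2⟩

/-! ### Disconnected structures -/

/-- A finite family of disjoint glued sets of facts can be fused to one with disjoint supports, so
its union inherits a bound on the treewidth of glued sets of facts. -/
theorem hasTreeDec_sUnion_of_glue {𝒞 : Set (RelStr ar V)}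
    (hk : ∀ F, Glue 𝒞 F → HasTreeDec F k) (𝒟 : Set (Set (RelFact ar V))) (hfin : 𝒟.Finite)
    (h𝒟 : ∀ F ∈ 𝒟, Glue 𝒞 F) (hdis : 𝒟.PairwiseDisjoint id) : HasTreeDec (⋃₀ 𝒟) k := by
  induction hn : 𝒟.ncard using Nat.strong_induction_on generalizing 𝒟 with
  | _ n ih =>
    subst hn
    rcases 𝒟.eq_empty_or_nonempty with rfl | ⟨F, hF⟩
    · rw [Set.sUnion_empty]
      exact hasTreeDec_empty
    have hlt : (𝒟 \ {F}).ncard < 𝒟.ncard := Set.ncard_sdiff_singleton_lt_of_mem hF hfin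
    -- A member that meets `F` is fused with it, which leaves fewer members. If there is none, `F`
    -- shares no element with the rest.
    by_cases hmeet : ∃ G ∈ 𝒟 \ {F}, (supp F ∩ supp G).Nonempty
    · obtain ⟨G, ⟨hG, hne⟩, hFG⟩ := hmeet
      have hlt' : ((𝒟 \ {F}) \ {G}).ncard < (𝒟 \ {F}).ncard :=
        Set.ncard_sdiff_singleton_lt_of_mem ⟨hG, hne⟩ (hfin.sdiff)
      have hd : Disjoint F G := hdis hF hG (Ne.symm hne)
      have hU : ⋃₀ 𝒟 = ⋃₀ (insert (F ∪ G) ((𝒟 \ {F}) \ {G})) := by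
        ext p
        constructor
        · rintro ⟨H, hH, hp⟩
          by_cases h1 : H = F
          · exact ⟨_, Or.inl rfl, Or.inl (h1 ▸ hp)⟩
          by_cases h2 : H = G
          · exact ⟨_, Or.inl rfl, Or.inr (h2 ▸ hp)⟩
          exact ⟨H, Or.inr ⟨⟨hH, h1⟩, h2⟩, hp⟩
        · rintro ⟨H, rfl | hH, hp⟩
          · exact hp.elim (fun hp => ⟨F, hF, hp⟩) fun hp => ⟨G, hG, hp⟩
          · exact ⟨H, hH.1.1, hp⟩
      rw [hU]
      refine ih _ ?_ _ ((hfin.sdiff.sdiff).insert _) ?_ ?_ rfl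
      · have := Set.ncard_insert_le (F ∪ G) ((𝒟 \ {F}) \ {G})
        omega
      · rintro H (rfl | hH)
        · exact Glue.union F G (h𝒟 F hF) (h𝒟 G hG) hFG hd
        · exact h𝒟 H hH.1.1
      · refine Set.PairwiseDisjoint.insert
          (hdis.subset (Set.sdiff_subset.trans Set.sdiff_subset)) fun H hH _ => ?_
        exact Disjoint.sup_left (hdis hF hH.1.1 (Ne.symm hH.1.2)) (hdis hG hH.1.1 (Ne.symm hH.2))
    · have hU : ⋃₀ 𝒟 = F ∪ ⋃₀ (𝒟 \ {F}) := by
        rw [← Set.sUnion_insert, Set.insert_sdiff_singleton, Set.insert_eq_of_mem hF]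
      rw [hU]
      refine (hk F (h𝒟 F hF)).union_of_disjoint (ih _ hlt _ hfin.sdiff (fun H hH => h𝒟 H hH.1)
        (hdis.subset Set.sdiff_subset) rfl) ?_
      rw [Set.disjoint_left]
      rintro x hxF ⟨p, ⟨G, hG, hp⟩, hx⟩
      exact hmeet ⟨G, hG, x, hxF, p, hp, hx⟩

/-- Every set of facts glued from the structures in `𝒮` is a union of disjoint sets of facts glued
from their connected components. -/
theorem Glue.exists_sUnion_split [Finite R] (har : ∀ r, 1 ≤ ar r) {𝒮 : Set (RelStr ar V)}
    (h : Glue 𝒮 F) : ∃ 𝒟 : Set (Set (RelFact ar V)), 𝒟.Finite ∧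
      (∀ G ∈ 𝒟, Glue (RelStr.split 𝒮) G) ∧ 𝒟.PairwiseDisjoint id ∧ F = ⋃₀ 𝒟 := by
  induction h with
  | base S π hS =>
    refine ⟨(fun x => RelFact.rename π '' component S.facts x) '' S.supp,
      S.supp_finite.image _, ?_, ?_, ?_⟩
    · rintro _ ⟨x, hx, rfl⟩
      obtain ⟨T, hT, hTS⟩ := RelStr.component_mem_split hS hx
      simp only [← hTS]
      exact Glue.base T π hT
    · rintro _ ⟨x, hx, rfl⟩ _ ⟨y, hy, rfl⟩ hne
      refine (Set.disjoint_image_iff (injective_rename π.injective)).2 ?_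
      rw [Set.disjoint_left]
      intro p hpx hpy
      refine hne ?_
      obtain ⟨z, hz⟩ := range_nonempty har p
      have hxy : Link S.facts x y := (hpx.2 z hz).trans (hpy.2 z hz).symm
      have : component S.facts x = component S.facts y := Set.ext fun q =>
        ⟨fun hq => ⟨hq.1, fun w hw => hxy.symm.trans (hq.2 w hw)⟩,
          fun hq => ⟨hq.1, fun w hw => hxy.trans (hq.2 w hw)⟩⟩
      simp only [this]
    · rw [Set.sUnion_image]
      ext p
      simp only [Set.mem_iUnion, exists_prop]
      constructor
      · rintro ⟨q, hq, rfl⟩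
        obtain ⟨z, hz⟩ := range_nonempty har q
        exact ⟨z, S.supp_facts ▸ range_subset_supp hq hz, q, mem_component hq hz .refl, rfl⟩
      · rintro ⟨x, _, q, hq, rfl⟩
        exact ⟨q, hq.1, rfl⟩
  | union F G _ _ _ hd ihF ihG =>
    obtain ⟨𝒟, h1, h2, h3, rfl⟩ := ihF
    obtain ⟨ℰ, k1, k2, k3, rfl⟩ := ihG
    refine ⟨𝒟 ∪ ℰ, h1.union k1, fun H hH => hH.elim (h2 H) (k2 H), ?_, ?_⟩
    · rw [Set.pairwiseDisjoint_union]
      exact ⟨h3, k3, fun H hH K hK _ =>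
        hd.mono (Set.subset_sUnion_of_mem hH) (Set.subset_sUnion_of_mem hK)⟩
    · rw [Set.sUnion_union]

theorem Glue.hasTreeDec_of_split [Finite R] (har : ∀ r, 1 ≤ ar r) {𝒮 : Set (RelStr ar V)}
    (hk : ∀ F, Glue (RelStr.split 𝒮) F → HasTreeDec F k) (h : Glue 𝒮 F) : HasTreeDec F k := by
  obtain ⟨𝒟, h1, h2, h3, rfl⟩ := h.exists_sUnion_split har
  exact hasTreeDec_sUnion_of_glue hk 𝒟 h1 h2 h3

end RelFact

/-! ### Abundant colours -/

namespace RelFact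

variable {R : Type u} {ar : R → ℕ} {V : Type v}

/-- A colour is abundant if it occurs at least three times in some glued set of facts. -/
def Abundant (𝒞 : Set (RelStr ar V)) (C : Set R) : Prop :=
  ∃ F, Glue 𝒞 F ∧ 2 < {x ∈ supp F | colour F x = C}.ncard

theorem finite_colourClass [Finite R] {𝒞 : Set (RelStr ar V)} {F : Set (RelFact ar V)}
    (h : Glue 𝒞 F) (C : Set R) : {x ∈ supp F | colour F x = C}.Finite :=
  (finite_supp h.finite).subset fun _ hx => hx.1

end RelFact

namespace RelStr

open RelFact

variable {R : Type u} {ar : R → ℕ} {V : Type v}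

theorem count_multisetAbs [Finite R] [DecidableEq (Set R)] (S : RelStr ar V) (C : Set R) :
    S.multisetAbs.count C = {x ∈ S.supp | S.colour x = C}.ncard := by
  classical
  unfold multisetAbs
  rw [Multiset.count_map, ← Finset.filter_val, Finset.card_val, ← Set.ncard_coe_finset]
  congr 1
  ext x
  simp [eq_comm]

/-- The support is renamed injectively between a fusion and its set of facts, so multiplicities of
colours agree. -/
theorem abundant_iff [Finite R] [DecidableEq (Set R)] (har : ∀ r, 1 ≤ ar r)
    {𝒞 : Set (RelStr ar V)} {C : Set R} :
    Abundant 𝒞 C ↔ ∃ S ∈ fusionClosure 𝒞, 2 < S.multisetAbs.count C := by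
  simp only [count_multisetAbs]
  constructor
  · rintro ⟨F, hF, hC⟩
    obtain ⟨S, hS, f, hf, rfl⟩ := exists_fusionClosure_of_glue hF
    rw [← supp_facts] at hf
    refine ⟨S, hS, hC.trans_le ?_⟩
    refine (Set.ncard_le_ncard (t := f '' {x ∈ S.supp | S.colour x = C}) ?_ ?_).trans
      (Set.ncard_image_le ?_)
    · rintro x ⟨hx, hxC⟩
      rw [supp_rename] at hx
      obtain ⟨x, hx, rfl⟩ := hx
      rw [colour_rename hf hx] at hxC
      rw [supp_facts] at hx
      exact ⟨x, ⟨hx, hxC⟩, rfl⟩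
    · exact (S.supp_finite.subset fun x hx => hx.1).image f
    · exact S.supp_finite.subset fun x hx => hx.1
  · rintro ⟨S, hS, hC⟩
    refine ⟨S.facts, glue_of_mem_fusionClosure har hS, ?_⟩
    rwa [supp_facts]

theorem triple_mem_kMultisetAbs_iff [Finite R] (har : ∀ r, 1 ≤ ar r) {𝒞 : Set (RelStr ar V)}
    {C : Set R} : {C, C, C} ∈ kMultisetAbs 3 (fusionClosure 𝒞) ↔ Abundant 𝒞 C := by
  classical
  rw [abundant_iff har]
  refine exists_congr fun S => and_congr_right fun _ => ?_
  rw [show ({C, C, C} : Multiset (Set R)) = Multiset.replicate 3 C from rfl,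
    ← Multiset.le_count_iff_replicate_le]
  simp [Nat.succ_le_iff]

/-! ### From colour schemes to bounded treewidth -/

/-- Green colours are not abundant, so each occurs at most twice, and there are finitely many
colours. -/
theorem ncard_greens_le [Finite R] {𝒞 : Set (RelStr ar V)} {B : Set (Set R)}
    (h : ∀ C, ¬ Misses B C → C ∉ B → ¬ Abundant 𝒞 C) {F : Set (RelFact ar V)} (hF : Glue 𝒞 F) :
    (greens B F).ncard ≤ 2 * Nat.card (Set R) := by
  classical
  have hfin : (greens B F).Finite := (finite_supp hF.finite).subset fun _ hx => hx.1
  have := Fintype.ofFinite (Set R)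
  rw [Set.ncard_eq_toFinset_card _ hfin, Nat.card_eq_fintype_card]
  refine (Finset.card_le_mul_card_image (f := RelFact.colour F) _ 2 fun C hC => ?_).trans
    (Nat.mul_le_mul_left 2 (Finset.card_le_univ _))
  obtain ⟨x, hx, rfl⟩ := Finset.mem_image.1 hC
  have hx' := (hfin.mem_toFinset.1 hx).2
  by_contra! hlt
  refine h _ hx'.1 hx'.2 ⟨F, hF, hlt.trans_le ?_⟩
  rw [← Set.ncard_coe_finset]
  refine Set.ncard_le_ncard (fun y hy => ?_) (finite_colourClass hF _)
  have := Finset.mem_filter.1 hy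
  exact ⟨(hfin.mem_toFinset.1 this.1).1, this.2⟩

theorem ConformsTo.treewidthBounded [Finite R] (har : ∀ r, 1 ≤ ar r) {𝒮 : Set (RelStr ar V)}
    (h𝒮 : TreewidthBounded 𝒮) {K : RGBScheme R} (h : ConformsTo (split 𝒮) K) :
    TreewidthBounded (fusionClosure 𝒮) := by
  classical
  obtain ⟨k, hk⟩ := treewidthBounded_iff.1 h𝒮
  -- The upward closure makes blueness survive fusion. It still intersects pairwise and is missed by
  -- exactly the red colours; only some green colours are turned blue.
  let B : Set (Set R) := {C | ∃ D ∈ K.blue, D ⊆ C}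
  have hblue : K.blue ⊆ B := fun C hC => ⟨C, hC, subset_rfl⟩
  have hup : ∀ C ∈ B, ∀ D, C ⊆ D → D ∈ B := fun C ⟨E, hE, hEC⟩ D hCD => ⟨E, hE, hEC.trans hCD⟩
  have hint : ∀ C ∈ B, ∀ D ∈ B, C ∩ D ≠ ∅ := fun C ⟨C', hC', hCC⟩ D ⟨D', hD', hDD⟩ h0 =>
    K.blue_meets_blue C' hC' D' hD' (Set.eq_empty_of_subset_empty
      (h0 ▸ Set.inter_subset_inter hCC hDD))
  have hred : ∀ C, Misses B C ↔ C ∈ K.red := by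
    intro C
    constructor
    · rintro ⟨D, ⟨D', hD', hDD⟩, hCD⟩
      have h0 : C ∩ D' = ∅ :=
        Set.eq_empty_of_subset_empty (hCD ▸ Set.inter_subset_inter_right C hDD)
      rcases (K.cover ▸ Set.mem_univ C : C ∈ K.red ∪ K.green ∪ K.blue) with (hC | hC) | hC
      · exact hC
      · exact (K.green_meets_blue C hC D' hD' h0).elim
      · exact (K.blue_meets_blue C hC D' hD' h0).elim
    · intro hC
      obtain ⟨D, hD, hCD⟩ := K.red_misses_blue C hC
      exact ⟨D, hblue hD, hCD⟩
  rw [treewidthBounded_fusionClosure_iff har]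
  refine ⟨k + 2 + 2 * (2 * Nat.card (Set R)), fun F hF =>
    hF.hasTreeDec_of_split har fun F hF => ?_⟩
  refine (Glue.oneRed_or_noRed har hup hint ?_ ?_ (fun F hF => ncard_greens_le ?_ hF) hF).elim
    (fun h => h.2.mono (by omega)) fun h => h.2.hasTreeDec
  · intro S hS
    obtain ⟨T, hT, hST, -⟩ := exists_of_mem_split hS
    exact (hk T hT).subset hST
  · intro S hS
    by_cases hno : NoRed B S.facts
    · exact Or.inr hno
    · unfold NoRed at hno
      push Not at hno
      obtain ⟨x, hx, hm⟩ := hno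
      refine Or.inl ⟨x, hx, hm, fun y hy hne => hblue ?_⟩
      rw [supp_facts] at hx hy
      exact h.1 S hS x hx ((hred _).1 hm) y ⟨hy, hne⟩
  · intro C hC hCB hab
    obtain ⟨S, hS, hlt⟩ := (abundant_iff har).1 hab
    have hCg : C ∈ K.green := by
      rcases (K.cover ▸ Set.mem_univ C : C ∈ K.red ∪ K.green ∪ K.blue) with (h | h) | h
      · exact (hC ((hred C).2 h)).elim
      · exact h
      · exact (hCB (hblue h)).elim
    have := h.2 S hS C hCg
    exact absurd hlt (not_lt.2 (by convert this))

end RelStr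

/-! ### Attaching a copy at a single element -/

namespace RelFact

variable {R : Type u} {ar : R → ℕ} {V : Type v} [Finite R] {𝒞 : Set (RelStr ar V)}
  {F G : Set (RelFact ar V)}

/-- A copy of `G` can be glued to `F` at a single element, if the colours there are disjoint. -/
theorem Glue.exists_attach (hF : Glue 𝒞 F) (hG : Glue 𝒞 G) {a b : V} (ha : a ∈ supp F)
    (hb : b ∈ supp G) (hc : colour F a ∩ colour G b = ∅) :
    ∃ π : Equiv.Perm V, π b = a ∧ supp F ∩ supp (RelFact.rename π '' G) = {a} ∧
      Glue 𝒞 (F ∪ RelFact.rename π '' G) := by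
  classical
  have := hF.infinite
  -- First `b` is brought to `a`; then `τ` fixes `a` and moves the rest of the copy away from `F`.
  let σ := Equiv.swap b a
  have hG' := hG.rename_perm σ
  have haG : a ∈ supp (RelFact.rename σ '' G) := by
    rw [supp_rename]
    exact ⟨b, hb, Equiv.swap_apply_left b a⟩
  obtain ⟨τ, hτ1, hτ2⟩ := (Set.finite_singleton a).exists_perm_avoid (finite_supp hG'.finite)
    (finite_supp hF.finite)
  have hba : (σ.trans τ) b = a := by
    rw [Equiv.trans_apply, Equiv.swap_apply_left]
    exact hτ1 a rfl
  have hsupp : supp F ∩ supp (RelFact.rename (σ.trans τ) '' G) = {a} := by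
    refine subset_antisymm ?_ ?_
    · rintro x ⟨hxF, hx⟩
      rw [supp_rename] at hx
      obtain ⟨y, hy, rfl⟩ := hx
      by_contra hne
      refine hτ2 (σ y) (by rw [supp_rename]; exact ⟨y, hy, rfl⟩) (fun h => hne ?_) (Or.inr hxF)
      change τ (σ y) = a
      rw [show σ y = a from h]
      exact hτ1 a rfl
    · rintro _ rfl
      refine ⟨ha, ?_⟩
      rw [supp_rename]
      exact ⟨b, hb, hba⟩
  refine ⟨σ.trans τ, hba, hsupp, Glue.union _ _ hF (hG.rename_perm _) ?_ ?_⟩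
  · rw [hsupp]
    exact Set.singleton_nonempty a
  · refine disjoint_of_supp_inter_subset hsupp.subset ?_
    rw [← hba, colour_rename (Equiv.injective _).injOn hb, hba]
    exact hc

end RelFact

/-! ### The colour scheme of the abundant colours -/

namespace RelStr

open RelFact

variable {R : Type u} {ar : R → ℕ} {V : Type v} [Finite R]

/-- If an element of a structure misses an abundant colour, then the colours of all other elements
are abundant. -/
theorem abundant_of_misses (har : ∀ r, 1 ≤ ar r) {𝒞 : Set (RelStr ar V)} {G : Set (RelFact ar V)}
    {C : Set R} (hC : Abundant 𝒞 C) (hG : Glue 𝒞 G) {x y : V} (hx : x ∈ RelFact.supp G)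
    (hxC : RelFact.colour G x ∩ C = ∅) (hy : y ∈ RelFact.supp G) (hxy : y ≠ x) :
    Abundant 𝒞 (RelFact.colour G y) := by
  obtain ⟨F, hF, hlt⟩ := hC
  obtain ⟨a, b, c, ⟨ha, haC⟩, ⟨hb, hbC⟩, ⟨hc, hcC⟩, hab, hac, hbc⟩ :=
    (Set.two_lt_ncard_iff (finite_colourClass hF C)).1 hlt
  rw [Set.inter_comm] at hxC
  -- attach the copy at `d` to `F`
  have step : ∀ F : Set (RelFact ar V), Glue 𝒞 F → ∀ d ∈ RelFact.supp F, RelFact.colour F d = C →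
      ∃ F' z, Glue 𝒞 F' ∧ z ∉ RelFact.supp F ∧ z ∈ RelFact.supp F' ∧
        RelFact.supp F ⊆ RelFact.supp F' ∧
        RelFact.colour F' z = RelFact.colour G y ∧
        ∀ e ∈ RelFact.supp F, e ≠ d → RelFact.colour F' e = RelFact.colour F e := by
    intro F hF d hd hdC
    -- The copy meets `F` only at `d`. Its element `π y` is therefore new and keeps its colour, and
    -- the other elements of `F` remain available for further copies.
    obtain ⟨π, hπ, hI, hU⟩ := hF.exists_attach hG hd hx (by rw [hdC]; exact hxC)
    have hyG : π y ∈ RelFact.supp (RelFact.rename π '' G) := by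
      rw [supp_rename]
      exact ⟨y, hy, rfl⟩
    have hyF : π y ∉ RelFact.supp F := fun h =>
      hxy (π.injective ((hI.subset ⟨h, hyG⟩ : π y = d).trans hπ.symm))
    refine ⟨_, π y, hU, hyF, supp_mono Set.subset_union_right hyG,
      supp_mono Set.subset_union_left, ?_, fun e he hne => ?_⟩
    · rw [colour_union_right har hyF, colour_rename π.injective.injOn hy]
    · exact colour_union_left har fun h => hne (hI.subset ⟨he, h⟩)
  obtain ⟨F₁, z₁, hF₁, hz₁, hz₁', hs₁, hcz₁, hc₁⟩ := step F hF a ha haC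
  obtain ⟨F₂, z₂, hF₂, hz₂, hz₂', hs₂, hcz₂, hc₂⟩ := step F₁ hF₁ b (hs₁ hb)
    ((hc₁ b hb hab.symm).trans hbC)
  obtain ⟨F₃, z₃, hF₃, hz₃, hz₃', hs₃, hcz₃, hc₃⟩ := step F₂ hF₂ c (hs₂ (hs₁ hc))
    (((hc₂ c (hs₁ hc) hbc.symm).trans (hc₁ c hc hac.symm)).trans hcC)
  refine ⟨F₃, hF₃, (Set.two_lt_ncard_iff (finite_colourClass hF₃ _)).2
    ⟨z₁, z₂, z₃, ⟨hs₃ (hs₂ hz₁'), ?_⟩, ⟨hs₃ hz₂', ?_⟩, ⟨hz₃', hcz₃⟩, ?_, ?_, ?_⟩⟩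
  · rw [hc₃ _ (hs₂ hz₁') (fun h => hz₁ (h ▸ hc)), hc₂ _ hz₁' (fun h => hz₁ (h ▸ hb)), hcz₁]
  · rw [hc₃ _ hz₂' (fun h => hz₂ (h ▸ hs₁ hc)), hcz₂]
  · exact fun h => hz₂ (h ▸ hz₁')
  · exact fun h => hz₃ (h ▸ hs₂ hz₁')
  · exact fun h => hz₃ (h ▸ hz₂')

/-- If the abundant colours pairwise meet, they are the blue colours of a colour scheme. -/
theorem exists_conformsTo (har : ∀ r, 1 ≤ ar r) {𝒞 : Set (RelStr ar V)}
    (h : ∀ C D, Abundant 𝒞 C → Abundant 𝒞 D → C ∩ D ≠ ∅) :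
    ∃ K : RGBScheme R, ConformsTo 𝒞 K := by
  classical
  refine ⟨{ red := {C | ∃ D, Abundant 𝒞 D ∧ C ∩ D = ∅},
            green := {C | ¬ Abundant 𝒞 C ∧ ¬ ∃ D, Abundant 𝒞 D ∧ C ∩ D = ∅},
            blue := {C | Abundant 𝒞 C},
            cover := ?_, red_green := ?_, red_blue := ?_, green_blue := ?_,
            blue_meets_blue := fun C hC D hD => h C D hC hD,
            green_meets_blue := fun C hC D hD h0 => hC.2 ⟨D, hD, h0⟩,
            red_misses_blue := fun C hC => hC }, ?_, ?_⟩
  · refine Set.eq_univ_of_forall fun C => ?_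
    by_cases h1 : Abundant 𝒞 C
    · exact Or.inr h1
    · by_cases h2 : ∃ D, Abundant 𝒞 D ∧ C ∩ D = ∅
      · exact Or.inl (Or.inl h2)
      · exact Or.inl (Or.inr ⟨h1, h2⟩)
  · exact Set.eq_empty_of_forall_notMem fun C hC => hC.2.2 hC.1
  · refine Set.eq_empty_of_forall_notMem ?_
    rintro C ⟨⟨D, hD, hCD⟩, hC⟩
    exact h C D hC hD hCD
  · exact Set.eq_empty_of_forall_notMem fun C hC => hC.1.1 hC.2
  · rintro S hS x hx ⟨D, hD, hxD⟩ y ⟨hy, hxy⟩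
    rw [← supp_facts] at hx hy
    exact abundant_of_misses har hD (Glue.of_mem hS) hx hxD hy hxy
  · intro S hS C hC
    by_contra! hlt
    exact hC.1 ((abundant_iff har).2 ⟨S, hS, by convert hlt⟩)

end RelStr

/-! ### Extending fusions of components to fusions of whole structures -/

namespace RelFact

variable {R : Type u} {ar : R → ℕ} {V : Type v}

/-- `F` consists of all facts of `G` that meet the support of `F`. -/
def IsUnionOfComponents (F G : Set (RelFact ar V)) : Prop :=
  F ⊆ G ∧ ∀ p ∈ G, ∀ x ∈ Set.range p.2, x ∈ supp F → p ∈ F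

variable [Finite R] {𝒮 : Set (RelStr ar V)} {F G : Set (RelFact ar V)}

/-- The support of `F` is fixed, and all other elements are moved away from it and from `C`. So the
extension of `F` causes no accidental meetings with another set of facts. -/
theorem Glue.exists_move (hG : Glue 𝒮 G) (hFG : IsUnionOfComponents F G)
    {C : Set V} (hC : C.Finite) :
    ∃ G', Glue 𝒮 G' ∧ IsUnionOfComponents F G' ∧ supp G' ∩ C ⊆ supp F := by
  have := hG.infinite
  have hF : F.Finite := hG.finite.subset hFG.1
  obtain ⟨σ, hσ1, hσ2⟩ := (finite_supp hF).exists_perm_avoid (finite_supp hG.finite) hC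
  have hFσ : RelFact.rename σ '' F = F := image_rename_of_fixed hσ1
  refine ⟨RelFact.rename σ '' G, hG.rename_perm σ, ⟨?_, ?_⟩, ?_⟩
  · rw [← hFσ]
    exact Set.image_mono hFG.1
  · rintro _ ⟨p, hp, rfl⟩ _ ⟨i, rfl⟩ hx
    have hpi : p.2 i ∈ supp F := by
      by_contra hno
      exact hσ2 _ ⟨p, hp, i, rfl⟩ hno (Or.inl hx)
    rw [← hFσ]
    exact ⟨p, hFG.2 p hp _ ⟨i, rfl⟩ hpi, rfl⟩
  · rintro x ⟨hx, hxC⟩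
    rw [supp_rename] at hx
    obtain ⟨y, hy, rfl⟩ := hx
    by_contra hno
    by_cases hyF : y ∈ supp F
    · rw [hσ1 y hyF] at hno
      exact hno hyF
    · exact hσ2 y hy hyF (Or.inr hxC)

/-- The other components of the structures used are carried along, renamed so that the two
extensions meet only where `F` and `G` do. A fact common to both extensions would then belong to
both `F` and `G`. -/
theorem Glue.exists_extension (har : ∀ r, 1 ≤ ar r) (h : Glue (RelStr.split 𝒮) F) :
    ∃ G, Glue 𝒮 G ∧ IsUnionOfComponents F G := by
  induction h with
  | base S π hS =>
    obtain ⟨T, hT, hST, -, hcomp⟩ := RelStr.exists_of_mem_split hS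
    refine ⟨_, Glue.base T π hT, Set.image_mono hST, ?_⟩
    rintro _ ⟨p, hp, rfl⟩ _ ⟨i, rfl⟩ hx
    rw [supp_rename] at hx
    obtain ⟨y, hy, hyi⟩ := hx
    cases π.injective hyi
    exact ⟨p, hcomp p hp _ ⟨i, rfl⟩ hy, rfl⟩
  | union F G hF hG hne hd ihF ihG =>
    obtain ⟨G₀, hG₀, hGG₀⟩ := ihG
    obtain ⟨G', hG', hGG, hI⟩ := hG₀.exists_move hGG₀ (finite_supp hF.finite)
    obtain ⟨F₀, hF₀, hFF₀⟩ := ihF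
    obtain ⟨F', hF', hFF, hI'⟩ := hF₀.exists_move hFF₀ (finite_supp hG'.finite)
    have hFG : ∀ x, x ∈ supp F' → x ∈ supp G' → x ∈ supp F ∧ x ∈ supp G := fun x h1 h2 =>
      have h := hI' ⟨h1, h2⟩
      ⟨h, hI ⟨h2, h⟩⟩
    refine ⟨F' ∪ G', Glue.union _ _ hF' hG' ?_ ?_, Set.union_subset_union hFF.1 hGG.1, ?_⟩
    · exact hne.mono (Set.inter_subset_inter (supp_mono hFF.1) (supp_mono hGG.1))
    · rw [Set.disjoint_left]
      intro p hp hp'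
      obtain ⟨x, hx⟩ := range_nonempty har p
      have h := hFG x (range_subset_supp hp hx) (range_subset_supp hp' hx)
      exact Set.disjoint_left.1 hd (hFF.2 p hp x hx h.1) (hGG.2 p hp' x hx h.2)
    · intro p hp x hx hxs
      rw [supp_union] at hxs
      rcases hp with hp | hp
      · refine Or.inl (hFF.2 p hp x hx ?_)
        exact hxs.elim id fun h => (hFG x (range_subset_supp hp hx) (supp_mono hGG.1 h)).1
      · refine Or.inr (hGG.2 p hp x hx ?_)
        exact hxs.elim (fun h => (hFG x (supp_mono hFF.1 h) (range_subset_supp hp hx)).2) id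

theorem Glue.linked (h : Glue (RelStr.split 𝒮) F) : Linked F := by
  induction h with
  | base S π hS =>
    obtain ⟨T, hT, hST, hl, -⟩ := RelStr.exists_of_mem_split hS
    exact hl.rename
  | union F G _ _ hne _ hF hG => exact hF.union hG hne

end RelFact

/-! ### Bags that meet a connected part -/

namespace RelFact

open SimpleGraph

variable {R : Type u} {ar : R → ℕ} {V : Type v} {F : Set (RelFact ar V)}

/-- The nodes whose bags meet the support of a connected set of facts are connected. -/
theorem Linked.connected_induce (hF : Linked F) (hne : (supp F).Nonempty) {N : Type*}
    {T : SimpleGraph N} {bag : N → Finset V}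
    (hc : ∀ x ∈ supp F, (T.induce {n | x ∈ bag n}).Connected)
    (hb : ∀ p ∈ F, ∃ n, Set.range p.2 ⊆ (bag n : Set V)) :
    (T.induce {n | ∃ x ∈ supp F, x ∈ bag n}).Connected := by
  obtain ⟨x, hx⟩ := hne
  obtain ⟨⟨a, ha⟩⟩ := (hc x hx).nonempty
  have hsub : ∀ y ∈ supp F, {n | y ∈ bag n} ⊆ {n | ∃ x ∈ supp F, x ∈ bag n} :=
    fun y hy n hn => ⟨y, hy, hn⟩
  have hpatch : ∀ y (hy : y ∈ supp F) m (hm : y ∈ bag m) n (hn : y ∈ bag n),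
      (T.induce {n | ∃ x ∈ supp F, x ∈ bag n}).Reachable ⟨m, y, hy, hm⟩ ⟨n, y, hy, hn⟩ :=
    fun y hy m hm n hn =>
      ((hc y hy).preconnected ⟨m, hm⟩ ⟨n, hn⟩).map (induceHomOfLE T (hsub y hy)).toHom
  have key : ∀ y, Link F x y → ∀ (hy : y ∈ supp F) n (hn : y ∈ bag n),
      (T.induce {n | ∃ x ∈ supp F, x ∈ bag n}).Reachable ⟨a, x, hx, ha⟩ ⟨n, y, hy, hn⟩ := by
    intro y h
    induction h with
    | refl => exact fun hy n hn => hpatch x hy a ha n hn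
    | tail hl h ih =>
      obtain ⟨p, hp, h1, h2⟩ := h
      intro hz n hn
      obtain ⟨m, hm⟩ := hb p hp
      exact (ih (range_subset_supp hp h1) m (hm h1)).trans (hpatch _ hz m (hm h2) n hn)
  rw [connected_iff_exists_forall_reachable]
  refine ⟨⟨a, x, hx, ha⟩, ?_⟩
  rintro ⟨n, y, hy, hn⟩
  exact key y (hF x hx y hy) hy n hn

end RelFact

/-! ### Grids -/

namespace RelFact

variable {R : Type u} {ar : R → ℕ} {V : Type v}

open Classical in
/-- Grid coordinates of the elements of copies of a set of facts with the ports `l`, `r`, `u`, `d`: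
the port `l` of a copy is the port `r` of its predecessor in the row, the port `u` of a copy is the
port `d` of its predecessor in the column. -/
noncomputable def gridCoord (l r u d : V) (c : ℕ × ℕ) (x : V) : (ℕ × ℕ) × V :=
  if x = l ∧ 0 < c.2 then ((c.1, c.2 - 1), r)
  else if x = u ∧ 0 < c.1 then ((c.1 - 1, c.2), d) else (c, x)

section

variable {l r u d : V}

theorem gridCoord_l (i j : ℕ) : gridCoord l r u d (i, j + 1) l = ((i, j), r) := by
  simp [gridCoord]

theorem gridCoord_r (hlr : l ≠ r) (hur : u ≠ r) (c : ℕ × ℕ) : gridCoord l r u d c r = (c, r) := by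
  simp [gridCoord, hlr.symm, hur.symm]

theorem gridCoord_u (hlu : l ≠ u) (i j : ℕ) : gridCoord l r u d (i + 1, j) u = ((i, j), d) := by
  simp [gridCoord, hlu.symm]

theorem gridCoord_d (hld : l ≠ d) (hud : u ≠ d) (c : ℕ × ℕ) : gridCoord l r u d c d = (c, d) := by
  simp [gridCoord, hld.symm, hud.symm]

/-- An element is found only in cells of two consecutive rows and of two consecutive columns. -/
theorem gridCoord_fst (c : ℕ × ℕ) (x : V) :
    (c.1 = (gridCoord l r u d c x).1.1 ∨ c.1 = (gridCoord l r u d c x).1.1 + 1) ∧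
      (c.2 = (gridCoord l r u d c x).1.2 ∨ c.2 = (gridCoord l r u d c x).1.2 + 1) := by
  unfold gridCoord
  split_ifs <;> simp <;> omega

theorem gridCoord_injective (hrd : r ≠ d) (c : ℕ × ℕ) :
    Function.Injective (gridCoord l r u d c) := by
  obtain ⟨i, j⟩ := c
  intro x x' h
  unfold gridCoord at h
  split_ifs at h <;> simp only [Prod.mk.injEq] at h <;> grind

/-- Distinct cells share only a port of adjacent neighbours. The cells to the right of and below a
given cell stay apart because `r ≠ d`. -/
theorem eq_of_gridCoord_eq (hrd : r ≠ d) {c c' : ℕ × ℕ} (hc : c ≠ c') {x x' : V}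
    (h : gridCoord l r u d c x = gridCoord l r u d c' x') :
    (x = l ∧ x' = r ∧ c = (c'.1, c'.2 + 1)) ∨ (x = r ∧ x' = l ∧ c' = (c.1, c.2 + 1)) ∨
      (x = u ∧ x' = d ∧ c = (c'.1 + 1, c'.2)) ∨ (x = d ∧ x' = u ∧ c' = (c.1 + 1, c.2)) := by
  obtain ⟨i, j⟩ := c
  obtain ⟨i', j'⟩ := c'
  unfold gridCoord at h
  split_ifs at h <;> simp only [Prod.mk.injEq] at h ⊢ <;> grind

end

end RelFact

/-! ### Copies of a set of facts in the cells of a grid -/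

namespace RelFact

variable {R : Type u} {ar : R → ℕ} {V : Type v}

/-- The copy of `D` in a grid cell. -/
noncomputable def gridCell (ι : (ℕ × ℕ) × V ↪ V) (l r u d : V) (D : Set (RelFact ar V))
    (c : ℕ × ℕ) : Set (RelFact ar V) :=
  rename (ι ∘ gridCoord l r u d c) '' D

/-- The union of the copies of `D` in some cells of the grid. -/
noncomputable def gridBlock (ι : (ℕ × ℕ) × V ↪ V) (l r u d : V) (D : Set (RelFact ar V))
    (s : Set (ℕ × ℕ)) : Set (RelFact ar V) :=
  ⋃ c ∈ s, gridCell ι l r u d D c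

variable {ι : (ℕ × ℕ) × V ↪ V} {l r u d : V} {D : Set (RelFact ar V)} {s t : Set (ℕ × ℕ)}

theorem gridBlock_union :
    gridBlock ι l r u d D (s ∪ t) = gridBlock ι l r u d D s ∪ gridBlock ι l r u d D t :=
  Set.biUnion_union ..

theorem gridBlock_mono (h : s ⊆ t) : gridBlock ι l r u d D s ⊆ gridBlock ι l r u d D t :=
  Set.biUnion_subset_biUnion_left h

theorem mem_supp_gridBlock {x : V} : x ∈ supp (gridBlock ι l r u d D s) ↔
    ∃ c ∈ s, ∃ y ∈ supp D, ι (gridCoord l r u d c y) = x := by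
  constructor
  · rintro ⟨p, hp, hx⟩
    simp only [gridBlock, Set.mem_iUnion, exists_prop] at hp
    obtain ⟨c, hc, hp⟩ := hp
    have hx' : x ∈ supp (gridCell ι l r u d D c) := ⟨p, hp, hx⟩
    rw [gridCell, supp_rename] at hx'
    obtain ⟨y, hy, rfl⟩ := hx'
    exact ⟨c, hc, y, hy, rfl⟩
  · rintro ⟨c, hc, y, hy, rfl⟩
    have hx' : ι (gridCoord l r u d c y) ∈ supp (gridCell ι l r u d D c) := by
      rw [gridCell, supp_rename]
      exact ⟨y, hy, rfl⟩
    exact supp_mono (Set.subset_biUnion_of_mem (u := gridCell ι l r u d D) hc) hx'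

/-- Adjacent cells share a single element, so a common fact would be a constant tuple there. It
would lie in both port colours, which are disjoint. -/
theorem disjoint_gridCell (har : ∀ r, 1 ≤ ar r) (hrd : r ≠ d)
    (hlr : colour D l ∩ colour D r = ∅) (hud : colour D u ∩ colour D d = ∅)
    {c c' : ℕ × ℕ} (hc : c ≠ c') :
    Disjoint (gridCell ι l r u d D c) (gridCell ι l r u d D c') := by
  rw [Set.disjoint_left]
  rintro _ ⟨⟨q, t⟩, ht, rfl⟩ ⟨⟨q', t'⟩, ht', heq⟩
  obtain rfl : q' = q := congrArg Sigma.fst heq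
  have hfun : ∀ i, gridCoord l r u d c (t i) = gridCoord l r u d c' (t' i) := by
    intro i
    simp only [rename, Sigma.mk.injEq, heq_eq_eq, true_and] at heq
    exact ι.injective (congrFun heq i).symm
  have key : ∀ a b, colour D a ∩ colour D b = ∅ → ¬ ((∀ i, t i = a) ∧ ∀ i, t' i = b) := by
    rintro a b hab ⟨h1, h2⟩
    obtain rfl : t = fun _ => a := funext h1
    obtain rfl : t' = fun _ => b := funext h2
    exact Set.notMem_empty q' (hab ▸ ⟨ht, ht'⟩)
  have hcases := fun i => eq_of_gridCoord_eq hrd hc (hfun i)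
  obtain ⟨i, j⟩ := c
  obtain ⟨i', j'⟩ := c'
  simp only [Prod.mk.injEq] at hcases
  rcases hcases ⟨0, har q'⟩ with ⟨-, -, h⟩ | ⟨-, -, h⟩ | ⟨-, -, h⟩ | ⟨-, -, h⟩
  · refine key l r hlr ⟨fun i => ?_, fun i => ?_⟩ <;>
    · rcases hcases i with h' | h' | h' | h' <;> first | exact h'.1 | exact h'.2.1 | omega
  · refine key r l (by rw [Set.inter_comm]; exact hlr) ⟨fun i => ?_, fun i => ?_⟩ <;>
    · rcases hcases i with h' | h' | h' | h' <;> first | omega | exact h'.1 | exact h'.2.1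
  · refine key u d hud ⟨fun i => ?_, fun i => ?_⟩ <;>
    · rcases hcases i with h' | h' | h' | h' <;> first | omega | exact h'.1 | exact h'.2.1
  · refine key d u (by rw [Set.inter_comm]; exact hud) ⟨fun i => ?_, fun i => ?_⟩ <;>
    · rcases hcases i with h' | h' | h' | h' <;> first | omega | exact h'.1 | exact h'.2.1

theorem disjoint_gridBlock (har : ∀ r, 1 ≤ ar r) (hrd : r ≠ d)
    (hlr : colour D l ∩ colour D r = ∅) (hud : colour D u ∩ colour D d = ∅)
    (hst : Disjoint s t) : Disjoint (gridBlock ι l r u d D s) (gridBlock ι l r u d D t) := by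
  simp only [gridBlock, Set.disjoint_iUnion_left, Set.disjoint_iUnion_right]
  intro c hc c' hc'
  exact disjoint_gridCell har hrd hlr hud fun h => Set.disjoint_left.1 hst hc' (h ▸ hc)

section Glue

variable [Finite R] {𝒞 : Set (RelStr ar V)}

theorem Glue.gridCell (hD : Glue 𝒞 D) (hrd : r ≠ d) (c : ℕ × ℕ) :
    Glue 𝒞 (gridCell ι l r u d D c) :=
  hD.rename (ι.injective.comp (gridCoord_injective hrd c)).injOn

variable (har : ∀ r, 1 ≤ ar r) (hD : Glue 𝒞 D) (hl : l ∈ supp D) (hr : r ∈ supp D)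
  (hu : u ∈ supp D) (hd : d ∈ supp D) (hlur : l ≠ u) (hlr' : l ≠ r) (hld : l ≠ d) (hur : u ≠ r)
  (hud' : u ≠ d) (hrd : r ≠ d)
  (hlr : colour D l ∩ colour D r = ∅) (hud : colour D u ∩ colour D d = ∅)

include har hD hl hr hlr' hur hrd hlr hud in
theorem Glue.gridRow (i n : ℕ) :
    Glue 𝒞 (gridBlock ι l r u d D {c | c.1 = i ∧ c.2 < n + 1}) := by
  induction n with
  | zero =>
    have : ({c | c.1 = i ∧ c.2 < 0 + 1} : Set (ℕ × ℕ)) = {(i, 0)} := by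
      ext ⟨a, b⟩
      simp
    rw [this, gridBlock, Set.biUnion_singleton]
    exact hD.gridCell hrd _
  | succ n ih =>
    have : ({c | c.1 = i ∧ c.2 < n + 1 + 1} : Set (ℕ × ℕ)) =
        {c | c.1 = i ∧ c.2 < n + 1} ∪ {(i, n + 1)} := by
      ext ⟨a, b⟩
      simp only [Set.mem_ofPred_eq, Set.mem_union, Set.mem_singleton_iff, Prod.mk.injEq]
      omega
    rw [this, gridBlock_union]
    refine Glue.union _ _ ih ?_ ?_ (disjoint_gridBlock har hrd hlr hud ?_)
    · rw [gridBlock, Set.biUnion_singleton]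
      exact hD.gridCell hrd _
    · refine ⟨ι ((i, n), r), ?_, ?_⟩ <;> rw [mem_supp_gridBlock]
      · exact ⟨(i, n), ⟨rfl, Nat.lt_succ_self n⟩, r, hr, by rw [gridCoord_r hlr' hur]⟩
      · exact ⟨(i, n + 1), rfl, l, hl, by rw [gridCoord_l]⟩
    · rw [Set.disjoint_singleton_right]
      exact fun h => absurd h.2 (lt_irrefl _)

include har hD hu hd hlur hld hud' hrd hlr hud in
theorem Glue.gridColumn (j n : ℕ) :
    Glue 𝒞 (gridBlock ι l r u d D {c | c.2 = j ∧ c.1 < n + 1}) := by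
  induction n with
  | zero =>
    have : ({c | c.2 = j ∧ c.1 < 0 + 1} : Set (ℕ × ℕ)) = {(0, j)} := by
      ext ⟨a, b⟩
      simp [and_comm]
    rw [this, gridBlock, Set.biUnion_singleton]
    exact hD.gridCell hrd _
  | succ n ih =>
    have : ({c | c.2 = j ∧ c.1 < n + 1 + 1} : Set (ℕ × ℕ)) =
        {c | c.2 = j ∧ c.1 < n + 1} ∪ {(n + 1, j)} := by
      ext ⟨a, b⟩
      simp only [Set.mem_ofPred_eq, Set.mem_union, Set.mem_singleton_iff, Prod.mk.injEq]
      omega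
    rw [this, gridBlock_union]
    refine Glue.union _ _ ih ?_ ?_ (disjoint_gridBlock har hrd hlr hud ?_)
    · rw [gridBlock, Set.biUnion_singleton]
      exact hD.gridCell hrd _
    · refine ⟨ι ((n, j), d), ?_, ?_⟩ <;> rw [mem_supp_gridBlock]
      · exact ⟨(n, j), ⟨rfl, Nat.lt_succ_self n⟩, d, hd, by rw [gridCoord_d hld hud']⟩
      · exact ⟨(n + 1, j), rfl, u, hu, by rw [gridCoord_u hlur]⟩
    · rw [Set.disjoint_singleton_right]
      exact fun h => absurd h.2 (lt_irrefl _)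

include har hD hl hr hu hd hlur hlr' hld hur hud' hrd hlr hud in
-- Whole rows are fused at once, along all their ports. Gluing needs only one common element, and
-- column `0` provides it.
theorem Glue.grid (m n : ℕ) :
    Glue 𝒞 (gridBlock ι l r u d D {c | c.1 < m + 1 ∧ c.2 < n + 1}) := by
  induction m with
  | zero =>
    have : ({c | c.1 < 0 + 1 ∧ c.2 < n + 1} : Set (ℕ × ℕ)) = {c | c.1 = 0 ∧ c.2 < n + 1} := by
      ext ⟨a, b⟩
      simp
    rw [this]
    exact Glue.gridRow har hD hl hr hlr' hur hrd hlr hud 0 n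
  | succ m ih =>
    have : ({c | c.1 < m + 1 + 1 ∧ c.2 < n + 1} : Set (ℕ × ℕ)) =
        {c | c.1 < m + 1 ∧ c.2 < n + 1} ∪ {c | c.1 = m + 1 ∧ c.2 < n + 1} := by
      ext ⟨a, b⟩
      simp only [Set.mem_ofPred_eq, Set.mem_union]
      omega
    rw [this, gridBlock_union]
    refine Glue.union _ _ ih (Glue.gridRow har hD hl hr hlr' hur hrd hlr hud _ _) ?_
      (disjoint_gridBlock har hrd hlr hud ?_)
    · refine ⟨ι ((m, 0), d), ?_, ?_⟩ <;> rw [mem_supp_gridBlock]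
      · exact ⟨(m, 0), ⟨Nat.lt_succ_self m, Nat.succ_pos n⟩, d, hd, by rw [gridCoord_d hld hud']⟩
      · exact ⟨(m + 1, 0), ⟨rfl, Nat.succ_pos n⟩, u, hu, by rw [gridCoord_u hlur]⟩
    · rw [Set.disjoint_left]
      rintro c ⟨h1, -⟩ ⟨h2, -⟩
      exact absurd h1 (by rw [h2]; exact lt_irrefl _)

end Glue

/-- A grid whose rows and columns are connected has large treewidth. -/
theorem not_hasTreeDec_gridBlock {k : ℕ} (hne : (supp D).Nonempty)
    (hrow : ∀ i, Linked (gridBlock ι l r u d D {c | c.1 = i ∧ c.2 < 2 * k + 1}))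
    (hcol : ∀ j, Linked (gridBlock ι l r u d D {c | c.2 = j ∧ c.1 < 2 * k + 1})) :
    ¬ HasTreeDec (gridBlock ι l r u d D {c | c.1 < 2 * k + 1 ∧ c.2 < 2 * k + 1}) k := by
  classical
  rintro ⟨N, fN, T, bag, hT, hP, hH, hc, hk⟩
  obtain ⟨z, hz⟩ := hne
  let row : ℕ → Set (RelFact ar V) := fun i =>
    gridBlock ι l r u d D {c | c.1 = i ∧ c.2 < 2 * k + 1}
  let col : ℕ → Set (RelFact ar V) := fun j =>
    gridBlock ι l r u d D {c | c.2 = j ∧ c.1 < 2 * k + 1}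
  have hzrow : ∀ i j, j < 2 * k + 1 → ι (gridCoord l r u d (i, j) z) ∈ supp (row i) :=
    fun i j hj => mem_supp_gridBlock.2 ⟨(i, j), ⟨rfl, hj⟩, z, hz, rfl⟩
  have hzcol : ∀ i j, i < 2 * k + 1 → ι (gridCoord l r u d (i, j) z) ∈ supp (col j) :=
    fun i j hi => mem_supp_gridBlock.2 ⟨(i, j), ⟨rfl, hi⟩, z, hz, rfl⟩
  let G : Set (RelFact ar V) := gridBlock ι l r u d D {c | c.1 < 2 * k + 1 ∧ c.2 < 2 * k + 1}
  have hsub : ∀ i j : Fin (2 * k + 1), row i ∪ col j ⊆ G := fun i j =>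
    Set.union_subset (gridBlock_mono fun c hc => ⟨hc.1 ▸ i.2, hc.2⟩)
      (gridBlock_mono fun c hc => ⟨hc.2, hc.1 ▸ j.2⟩)
  -- The crosses, each a row together with a column, are connected and pairwise meet, so one bag
  -- meets all of them.
  obtain ⟨n, hn⟩ := hT.exists_mem_of_pairwise_meet
    (fun ij : Fin (2 * k + 1) × Fin (2 * k + 1) =>
      {n | ∃ x ∈ supp (row ij.1 ∪ col ij.2), x ∈ bag n})
    (fun ij => by
      refine Linked.connected_induce ((hrow ij.1).union (hcol ij.2)
        ⟨_, hzrow ij.1 ij.2 ij.2.2, hzcol ij.1 ij.2 ij.1.2⟩) ?_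
        (fun x hx => hc x (supp_mono (hsub _ _) hx))
        (fun p hp => hH _ ⟨p, hsub _ _ hp, rfl⟩)
      exact ⟨_, supp_mono Set.subset_union_left (hzrow ij.1 ij.2 ij.2.2)⟩)
    (fun ij ij' => by
      have h1 := hzrow ij.1 ij'.2 ij'.2.2
      have h2 := hzcol ij.1 ij'.2 ij.1.2
      obtain ⟨⟨n, hn⟩⟩ := (hc _ (supp_mono (hsub ij.1 ij'.2)
        (supp_mono Set.subset_union_left h1))).nonempty
      exact ⟨n, ⟨_, supp_mono Set.subset_union_left h1, hn⟩,
        ⟨_, supp_mono Set.subset_union_right h2, hn⟩⟩)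
  -- Each of the at most `k` elements of the bag excludes two indices, so one of the `2 * k + 1`
  -- indices is free. A free row and a free column form a cross that the bag misses.
  have hfree : ∀ a : V → ℕ, ∃ i < 2 * k + 1, ∀ x ∈ bag n, i ≠ a x ∧ i ≠ a x + 1 := by
    intro a
    obtain ⟨i, hi, hi'⟩ := Finset.exists_mem_notMem_of_card_lt_card
      (s := (bag n).biUnion fun x => {a x, a x + 1}) (t := Finset.range (2 * k + 1)) (by
        rw [Finset.card_range]
        have h1 := Finset.card_biUnion_le_card_mul (bag n) (fun x => {a x, a x + 1}) 2
          fun x _ => Finset.card_le_two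
        have h2 := hk n
        omega)
    refine ⟨i, Finset.mem_range.1 hi, fun x hx => ?_⟩
    simp only [Finset.mem_biUnion, Finset.mem_insert, Finset.mem_singleton, not_exists,
      not_and, not_or] at hi'
    exact hi' x hx
  -- The extension is a left inverse of `ι`, by which the coordinates of an element are read off;
  -- the default value `((0, 0), z)` is irrelevant.
  have hι : ∀ c, (Function.extend ι id fun _ => ((0, 0), z)) (ι c) = c := fun c =>
    ι.injective.extend_apply _ _ c
  obtain ⟨i, hi, hi'⟩ := hfree fun x => (Function.extend ι id (fun _ => ((0, 0), z)) x).1.1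
  obtain ⟨j, hj, hj'⟩ := hfree fun x => (Function.extend ι id (fun _ => ((0, 0), z)) x).1.2
  obtain ⟨x, hx, hxn⟩ := hn (⟨i, hi⟩, ⟨j, hj⟩)
  have hi' := hi' x hxn
  have hj' := hj' x hxn
  rw [supp_union] at hx
  rcases hx with hx | hx
  · obtain ⟨c, ⟨hc1, -⟩, y, hy, rfl⟩ := mem_supp_gridBlock.1 hx
    rw [hι] at hi'
    have := (gridCoord_fst (l := l) (r := r) (u := u) (d := d) c y).1
    simp only at hc1
    omega
  · obtain ⟨c, ⟨hc1, -⟩, y, hy, rfl⟩ := mem_supp_gridBlock.1 hx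
    rw [hι] at hj'
    have := (gridCoord_fst (l := l) (r := r) (u := u) (d := d) c y).2
    simp only at hc1
    omega

end RelFact

/-! ### Unbounded treewidth from two disjoint abundant colours -/

namespace RelStr

open RelFact

variable {R : Type u} {ar : R → ℕ} {V : Type v} [Finite R]

/-- Two disjoint abundant colours of components allow for arbitrarily large grids. -/
theorem inter_ne_empty_of_treewidthBounded (har : ∀ r, 1 ≤ ar r) {𝒮 : Set (RelStr ar V)}
    (h : TreewidthBounded (fusionClosure 𝒮)) {C₁ C₂ : Set R} (h₁ : Abundant (split 𝒮) C₁)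
    (h₂ : Abundant (split 𝒮) C₂) : C₁ ∩ C₂ ≠ ∅ := by
  intro h0
  obtain ⟨k, hk⟩ := (treewidthBounded_fusionClosure_iff har).1 h
  obtain ⟨F₁, hF₁, hlt₁⟩ := h₁
  obtain ⟨F₂, hF₂, hlt₂⟩ := h₂
  obtain ⟨a, l, u, ⟨ha, haC⟩, ⟨hl, hlC⟩, ⟨hu, huC⟩, hal, hau, hlu⟩ :=
    (Set.two_lt_ncard_iff (finite_colourClass hF₁ C₁)).1 hlt₁
  obtain ⟨b, r, d, ⟨hb, hbC⟩, ⟨hr, hrC⟩, ⟨hd, hdC⟩, hbr, hbd, hrd⟩ :=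
    (Set.two_lt_ncard_iff (finite_colourClass hF₂ C₂)).1 hlt₂
  -- One element of each colour is spent on fusing the two sets at `a`. The remaining two of each
  -- are the ports: `l`, `u` of colour `C₁` and `π r`, `π d` of colour `C₂`.
  obtain ⟨π, hπ, hI, hD⟩ := hF₁.exists_attach hF₂ ha hb (by rw [haC, hbC, h0])
  set G := RelFact.rename π '' F₂ with hG
  have hleft : ∀ x ∈ RelFact.supp F₁, a ≠ x → x ∉ RelFact.supp G := fun x hx hax hxG =>
    hax (hI.subset ⟨hx, hxG⟩ : x = a).symm
  have hmem : ∀ x ∈ RelFact.supp F₂, π x ∈ RelFact.supp G := fun x hx => by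
    rw [hG, supp_rename]
    exact ⟨x, hx, rfl⟩
  have hright : ∀ x ∈ RelFact.supp F₂, b ≠ x → π x ∉ RelFact.supp F₁ := fun x hx hbx hxF =>
    hbx (π.injective (hπ.trans (hI.subset ⟨hxF, hmem x hx⟩ : π x = a).symm))
  have hcl : ∀ x ∈ RelFact.supp F₁, a ≠ x → RelFact.colour F₁ x = C₁ →
      RelFact.colour (F₁ ∪ G) x = C₁ := fun x hx hax hxC => by
    rw [colour_union_left har (hleft x hx hax), hxC]
  have hcr : ∀ x ∈ RelFact.supp F₂, b ≠ x → RelFact.colour F₂ x = C₂ →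
      RelFact.colour (F₁ ∪ G) (π x) = C₂ := fun x hx hbx hxC => by
    rw [colour_union_right har (hright x hx hbx), hG, colour_rename π.injective.injOn hx, hxC]
  have hne : ∀ x ∈ RelFact.supp F₁, a ≠ x → ∀ y ∈ RelFact.supp F₂, x ≠ π y :=
    fun x hx hax y hy hxy => hleft x hx hax (hxy ▸ hmem y hy)
  have := hF₁.infinite
  -- `V` is infinite, hence large enough to name the elements of all cells.
  obtain ⟨ι⟩ : Nonempty ((ℕ × ℕ) × V ↪ V) := by
    rw [← Cardinal.lift_mk_le']
    simp [Cardinal.mk_prod, Cardinal.aleph0_mul_eq (Cardinal.aleph0_le_mk V)]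
  have hlD : l ∈ RelFact.supp (F₁ ∪ G) := supp_mono Set.subset_union_left hl
  have huD : u ∈ RelFact.supp (F₁ ∪ G) := supp_mono Set.subset_union_left hu
  have hrD : π r ∈ RelFact.supp (F₁ ∪ G) := supp_mono Set.subset_union_right (hmem r hr)
  have hdD : π d ∈ RelFact.supp (F₁ ∪ G) := supp_mono Set.subset_union_right (hmem d hd)
  have hlr := hne l hl hal r hr
  have hld := hne l hl hal d hd
  have hur := hne u hu hau r hr
  have hud := hne u hu hau d hd
  have hrd' : π r ≠ π d := fun h => hrd (π.injective h)
  have clr : RelFact.colour (F₁ ∪ G) l ∩ RelFact.colour (F₁ ∪ G) (π r) = ∅ := by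
    rw [hcl l hl hal hlC, hcr r hr hbr hrC, h0]
  have cud : RelFact.colour (F₁ ∪ G) u ∩ RelFact.colour (F₁ ∪ G) (π d) = ∅ := by
    rw [hcl u hu hau huC, hcr d hd hbd hdC, h0]
  obtain ⟨E, hE, hEsub, -⟩ := (Glue.grid (ι := ι) har hD hlD hrD huD hdD hlu hlr hld hur hud hrd'
    clr cud (2 * k) (2 * k)).exists_extension har
  exact not_hasTreeDec_gridBlock ⟨l, hlD⟩
    (fun i => (Glue.gridRow har hD hlD hrD hlr hur hrd' clr cud i _).linked)
    (fun j => (Glue.gridColumn har hD huD hdD hlu hld hud hrd' clr cud j _).linked)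
    ((hk E hE).subset hEsub)

end RelStr

/-! ### The equivalence of the three conditions -/

theorem mainTheorem4 {R : Type*} [Finite R] (ar : R → ℕ) (har : ∀ r, 1 ≤ ar r) {V : Type*}
    (𝒮 : Set (RelStr ar V)) (h𝒮 : RelStr.TreewidthBounded 𝒮) :
    List.TFAE [
      RelStr.TreewidthBounded (RelStr.fusionClosure 𝒮),
      ∀ C₁ C₂ : Set R,
        {C₁, C₁, C₁} ∈ RelStr.kMultisetAbs 3 (RelStr.fusionClosure (RelStr.split 𝒮)) →
        {C₂, C₂, C₂} ∈ RelStr.kMultisetAbs 3 (RelStr.fusionClosure (RelStr.split 𝒮)) →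
        C₁ ∩ C₂ ≠ ∅,
      ∃ K : RGBScheme R, RelStr.ConformsTo (RelStr.split 𝒮) K] := by
  simp only [RelStr.triple_mem_kMultisetAbs_iff har]
  tfae_have 1 → 2 := fun h C₁ C₂ h₁ h₂ => RelStr.inter_ne_empty_of_treewidthBounded har h h₁ h₂
  tfae_have 2 → 3 := RelStr.exists_conformsTo har
  tfae_have 3 → 1 := fun ⟨_, hK⟩ => hK.treewidthBounded har h𝒮
  tfae_finish
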